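/- Let $\mathbb K=\mathbb C$ (or $\mathbb R$), let $M$ be a smooth manifold and write $C^\infty(\cdot)$ for smooth $\mathbb K$-valued functions, $\Gamma(T\,\cdot)$ for the derivations of $C^\infty(\cdot)$ (smooth vector fields). Let $A$ be a transitive Lie algebroid over $M$: a finitely generated projective $C^\infty(M)$-module with a Lie bracket and a surjective $C^\infty(M)$-linear Lie morphism $\rho:A\to\Gamma(TM)$ (the anchor) such that $[X,fY]=f[X,Y]+(\rho(X)f)\,Y$. Let $L=\ker\rho$. For open $U\subset M$ let $A_U$ be the restriction of $A$ to $U$ (sections over $U$ of the vector bundle defined by $A$) and $L_U=\ker\rho_U$. Let $\Omega^q(A,L)$ be the space of $C^\infty(M)$-multilinear alternating maps $A^q\to L$, and $\hat d$ its differential given by the Koszul formula for the adjoint representation of $A$ on $L$, $$(\hat d\omega)(X_0,\dots,X_q)=\sum_i(-1)^i[X_i,\omega(\dots,\widehat{X_i},\dots)]+\sum_{i<j}(-1)^{i+j}\omega([X_i,X_j],\dots,\widehat{X_i},\dots,\widehat{X_j},\dots).$$ Let $\mathfrak g$ be a finite-dimensional Lie algebra over $\mathbb K$. For $U\subset M$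 open let $\mathrm{TLA}(U,\mathfrak g)=\Gamma(TU)\oplus\Gamma(U\times\mathfrak g)$ be the trivial Lie algebroid, with anchor $X\oplus\gamma\mapsto X$ and bracket $[X\oplus\gamma,Y\oplus\eta]=[X,Y]\oplus(X\cdot\eta-Y\cdot\gamma+[\gamma,\eta])$. Let $\Omega^\bullet_{\mathrm{TLA}}(U,\mathfrak g)=\Omega^\bullet(U)\otimes\Lambda^\bullet\mathfrak g^*\otimes\mathfrak g$, i.e. the $C^\infty(U)$-multilinear alternating maps from $\mathrm{TLA}(U,\mathfrak g)$ to $\Gamma(U\times\mathfrak g)$, with its graded Lie bracket (exterior product of forms combined with the bracket of $\mathfrak g$) and the differential $\hat d_{\mathrm{TLA}}=d+s'$, where $d$ is the de Rham differential and $s'$ the Chevalley–Eilenberg differential for the adjoint representation of $\mathfrak g$. A local trivialization of $A$ is a triple $(U,\Psi,\nabla^0)$ in which $\Psi:\Gamma(U\times\mathfrak g)\to L_U$ is an isomorphism of Lie algebras and $C^\infty(U)$-modules, $\nabla^0:\Gamma(TU)\to A_U$ is a $C^\infty(U)$-linear Lie morphism with $\rho_U\circ\nabla^0=\mathrm{id}$,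 and $[\nabla^0_X,\Psi(\gamma)]=\Psi(X\cdot\gamma)$. It gives the isomorphism $S:\mathrm{TLA}(U,\mathfrak g)\to A_U$, $S(X\oplus\gamma)=\nabla^0_X+\Psi(\gamma)$, and the local expression $\omega_{\mathrm{loc}}=\Psi^{-1}\circ\omega|_U\circ S\in\Omega^q_{\mathrm{TLA}}(U,\mathfrak g)$ of $\omega\in\Omega^q(A,L)$. Let $(U_i,\Psi_i,\nabla^{0,i})_{i\in I}$ be a family of local trivializations of $A$ (for instance one whose $U_i$ cover $M$). On $U_{ij}=U_i\cap U_j$, with all trivializations restricted to $U_{ij}$, put $\alpha^i_j=\Psi_i^{-1}\circ\Psi_j$, $s_i^j=S_j^{-1}\circ S_i$ and $\hat\alpha^{\,i}_j(\theta)=\alpha^i_j\circ\theta\circ s_i^j$ for $\theta\in\Omega^\bullet_{\mathrm{TLA}}(U_{ij},\mathfrak g)$. Then: 1. for every $i$, every $q\ge 0$ and every $\omega\in\Omega^q(A,L)$, with $\omega_{\mathrm{loc}}$, $\Psi$, $S$ those of $(U_i,\Psi_i,\nabla^{0,i})$, one has $\hat d_{\mathrm{TLA}}\,\omega_{\mathrm{loc}}=\Psi^{-1}\circ(\hat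 d\omega)|_U\circ S$; 2. for all $i,j$ and every $\omega\in\Omega^q(A,L)$, the local expressions $\omega^i_{\mathrm{loc}}$, $\omega^j_{\mathrm{loc}}$ satisfy on $U_{ij}$ the relation $\hat d_{\mathrm{TLA}}\,\omega^i_{\mathrm{loc}}=\hat\alpha^{\,i}_j\bigl(\hat d_{\mathrm{TLA}}\,\omega^j_{\mathrm{loc}}\bigr)$; 3. for all $i,j$ the map $\hat\alpha^{\,i}_j:\Omega^\bullet_{\mathrm{TLA}}(U_{ij},\mathfrak g)\to\Omega^\bullet_{\mathrm{TLA}}(U_{ij},\mathfrak g)$ is an isomorphism of graded differential Lie algebras: it is linear and bijective in each degree, preserves the graded Lie bracket and commutes with $\hat d_{\mathrm{TLA}}$. -/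

import Mathlib

open scoped TensorProduct Manifold ContDiff Topology
open TopologicalSpace Filter

namespace LieAlgd

noncomputable section


/-! ### The Koszul differential -/

/-- The data that enter the Koszul formula for forms on the `R`-module `A` with values in the
`R`-module `W`: an anchor, a skew bracket on `A` and an action of `A` on `W`, with the Leibniz rules
that make the Koszul formula `R`-multilinear. -/
structure KoszulDatum (𝕜 R A W : Type*) [Field 𝕜] [CommRing R] [Algebra 𝕜 R]
    [AddCommGroup A] [Module 𝕜 A] [Module R A]
    [AddCommGroup W] [Module 𝕜 W] [Module R W] where
  anchor : A → Derivation 𝕜 R R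
  br : A →ₗ[𝕜] A →ₗ[𝕜] A
  act : A →ₗ[𝕜] W →ₗ[𝕜] W
  br_self : ∀ X, br X X = 0
  br_smul : ∀ (X Y : A) (f : R), br X (f • Y) = f • br X Y + anchor X f • Y
  act_smul_left : ∀ (f : R) (X : A) (w : W), act (f • X) w = f • act X w
  act_smul : ∀ (X : A) (f : R) (w : W), act X (f • w) = f • act X w + anchor X f • w

namespace KoszulDatum

variable {𝕜 R A W : Type*} [Field 𝕜] [CommRing R] [Algebra 𝕜 R]
    [AddCommGroup A] [Module 𝕜 A] [Module R A] [IsScalarTower 𝕜 R A]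
    [AddCommGroup W] [Module 𝕜 W] [Module R W] [IsScalarTower 𝕜 R W]
    (K : KoszulDatum 𝕜 R A W)

lemma br_swap (X Y : A) : K.br X Y = - K.br Y X := by
  have h := K.br_self (X + Y)
  simp only [map_add, LinearMap.add_apply, K.br_self, zero_add, add_zero] at h
  exact eq_neg_of_add_eq_zero_right h

lemma smul_br (X Y : A) (f : R) : K.br (f • X) Y = f • K.br X Y - K.anchor Y f • X := by
  rw [K.br_swap, K.br_smul, K.br_swap Y X]
  simp [neg_add_rev, sub_eq_add_neg, add_comm]

/-- `θ` regarded as an alternating map over `𝕜`. -/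
def overField {q : ℕ} (θ : A [⋀^Fin q]→ₗ[R] W) : A [⋀^Fin q]→ₗ[𝕜] W :=
  { θ.toMultilinearMap.restrictScalars 𝕜 with
    map_eq_zero_of_eq' := fun v _ _ h hij => θ.map_eq_zero_of_eq v h hij }

@[simp] lemma overField_apply {q : ℕ} (θ : A [⋀^Fin q]→ₗ[R] W) (v : Fin q → A) :
    overField (𝕜 := 𝕜) θ v = θ v := rfl

/-- `X ↦ ((Y₁, …, Y_q) ↦ X · θ(Y₁, …, Y_q))`. -/
def actForm {q : ℕ} (θ : A [⋀^Fin q]→ₗ[R] W) : A →ₗ[𝕜] A [⋀^Fin q]→ₗ[𝕜] W where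
  toFun X := (K.act X).compAlternatingMap (overField θ)
  map_add' X Y := by ext; simp
  map_smul' c X := by ext; simp

/-- `X ↦ ((Y₁, …, Y_q) ↦ ∑ₖ θ(Y₁, …, [X, Yₖ], …, Y_q))`. -/
def brForm {q : ℕ} (θ : A [⋀^Fin q]→ₗ[R] W) : A →ₗ[𝕜] A [⋀^Fin q]→ₗ[𝕜] W where
  toFun X :=
    { toFun := fun Y => ∑ k, θ (Function.update Y k (K.br X (Y k)))
      map_update_add' := fun {hd} Y i a b => by
        cases Subsingleton.elim hd (instDecidableEqFin q)
        rw [← Finset.sum_add_distrib]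
        refine Finset.sum_congr rfl fun k _ => ?_
        by_cases hk : k = i
        · subst hk; simp
        · simp only [Function.update_of_ne hk, Function.update_comm (Ne.symm hk), θ.map_update_add]
      map_update_smul' := fun {hd} Y i c a => by
        cases Subsingleton.elim hd (instDecidableEqFin q)
        rw [Finset.smul_sum]
        refine Finset.sum_congr rfl fun k _ => ?_
        by_cases hk : k = i
        · subst hk
          simp only [Function.update_self, Function.update_idem, map_smul]
          exact (overField (𝕜 := 𝕜) θ).map_update_smul Y k c (K.br X a)
        · simpa only [Function.update_of_ne hk, Function.update_comm (Ne.symm hk),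
            overField_apply] using (overField (𝕜 := 𝕜) θ).map_update_smul
              (Function.update Y k (K.br X (Y k))) i c a
      map_eq_zero_of_eq' := fun Y i j h hij => by
        rw [Fintype.sum_eq_add i j hij]
        · have e : Function.update Y j (K.br X (Y j))
              = Function.update Y i (K.br X (Y i)) ∘ Equiv.swap i j := by
            funext k
            by_cases hi : k = i
            · subst hi; simp [hij, h, Ne.symm hij]
            by_cases hj : k = j
            · subst hj; simp [h]
            · simp [Equiv.swap_apply_of_ne_of_ne hi hj, hi, hj]
          rw [e, θ.map_swap _ hij, add_neg_cancel]
        · rintro k ⟨hki, hkj⟩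
          exact θ.map_eq_zero_of_eq _ (by simp [Ne.symm hki, Ne.symm hkj, h]) hij }
  map_add' X Y := by ext; simp [Finset.sum_add_distrib]
  map_smul' c X := by
    ext v
    simp only [AlternatingMap.coe_mk, MultilinearMap.coe_mk, AlternatingMap.smul_apply,
      RingHom.id_apply, Finset.smul_sum, map_smul, LinearMap.smul_apply]
    exact Finset.sum_congr rfl fun k _ => (overField (𝕜 := 𝕜) θ).map_update_smul v k c _

/-- The Koszul formula, as an alternating map over `𝕜`. -/
def dField {q : ℕ} (θ : A [⋀^Fin q]→ₗ[R] W) : A [⋀^Fin (q + 1)]→ₗ[𝕜] W :=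
  AlternatingMap.alternatizeUncurryFin (K.actForm θ)
    - (2⁻¹ : 𝕜) • AlternatingMap.alternatizeUncurryFin (K.brForm θ)

/-- The first sum of the Koszul formula. -/
def actSum {q : ℕ} (θ : A [⋀^Fin q]→ₗ[R] W) (X : Fin (q + 1) → A) : W :=
  ∑ i : Fin (q + 1), (-1) ^ (i : ℕ) • K.act (X i) (θ (i.removeNth X))

/-- Twice the second sum of the Koszul formula. -/
def brSum {q : ℕ} (θ : A [⋀^Fin q]→ₗ[R] W) (X : Fin (q + 1) → A) : W :=
  ∑ i : Fin (q + 1), (-1) ^ (i : ℕ) •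
        ∑ k, θ (Function.update (i.removeNth X) k (K.br (X i) (i.removeNth X k)))

lemma dField_apply {q : ℕ} (θ : A [⋀^Fin q]→ₗ[R] W) (X : Fin (q + 1) → A) :
    K.dField θ X = K.actSum θ X - (2⁻¹ : 𝕜) • K.brSum θ X := by
  simp [dField, AlternatingMap.alternatizeUncurryFin_apply, actForm, brForm, actSum, brSum]

lemma removeNth_succ_cons {m : ℕ} {B : Type*} (j : Fin (m + 1)) (x : B) (Y : Fin (m + 1) → B) :
    j.succ.removeNth (Fin.cons x Y : Fin (m + 2) → B) = Fin.cons x (j.removeNth Y) := by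
  funext k
  refine Fin.cases ?_ (fun l => ?_) k <;> simp [Fin.removeNth]

lemma map_cons_smul {m : ℕ} (θ : A [⋀^Fin (m + 1)]→ₗ[R] W) (f : R) (x : A) (Z : Fin m → A) :
    θ (Fin.cons (f • x) Z) = f • θ (Fin.cons x Z) :=
  θ.toMultilinearMap.cons_smul Z f x

lemma map_cons_add {m : ℕ} (θ : A [⋀^Fin (m + 1)]→ₗ[R] W) (x y : A) (Z : Fin m → A) :
    θ (Fin.cons (x + y) Z) = θ (Fin.cons x Z) + θ (Fin.cons y Z) :=
  θ.toMultilinearMap.cons_add Z x y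

lemma map_update_eq {m : ℕ} (θ : A [⋀^Fin (m + 1)]→ₗ[R] W) (k : Fin (m + 1)) (x : A)
    (Y : Fin (m + 1) → A) :
    θ (Function.update Y k x) = (-1) ^ (k : ℕ) • θ (Fin.cons x (k.removeNth Y)) := by
  rw [← Fin.insertNth_removeNth]
  exact θ.map_insertNth k x (k.removeNth Y)

lemma actSum_smul {m : ℕ} (θ : A [⋀^Fin (m + 1)]→ₗ[R] W) (f : R) (x : A) (Y : Fin (m + 1) → A) :
    K.actSum θ (Fin.cons (f • x) Y) = f • K.actSum θ (Fin.cons x Y)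
      - ∑ j : Fin (m + 1), (-1) ^ (j : ℕ) • K.anchor (Y j) f • θ (Fin.cons x (j.removeNth Y)) := by
  simp only [actSum, Fin.sum_univ_succ (n := m + 1), Fin.cons_zero, Fin.cons_succ,
    Fin.removeNth_zero, Fin.tail_cons, removeNth_succ_cons, map_cons_smul, K.act_smul,
    K.act_smul_left, Fin.val_succ, pow_succ, smul_add, Finset.sum_add_distrib, Finset.smul_sum,
    mul_neg, mul_one, neg_smul, Finset.sum_neg_distrib, smul_neg, smul_comm f]
  abel

lemma brSum_smul {m : ℕ} (θ : A [⋀^Fin (m + 1)]→ₗ[R] W) (f : R) (x : A) (Y : Fin (m + 1) → A) :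
    K.brSum θ (Fin.cons (f • x) Y) = f • K.brSum θ (Fin.cons x Y)
      - (2 : 𝕜) • ∑ j : Fin (m + 1), (-1) ^ (j : ℕ) •
        K.anchor (Y j) f • θ (Fin.cons x (j.removeNth Y)) := by
  have h0 : ∑ k, θ (Function.update Y k (K.br (f • x) (Y k)))
      = f • (∑ k, θ (Function.update Y k (K.br x (Y k))))
        - ∑ k : Fin (m + 1), (-1) ^ (k : ℕ) •
          K.anchor (Y k) f • θ (Fin.cons x (k.removeNth Y)) := by
    rw [Finset.smul_sum, ← Finset.sum_sub_distrib]
    refine Finset.sum_congr rfl fun k _ => ?_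
    rw [K.smul_br, θ.map_update_sub, θ.map_update_smul, θ.map_update_smul, map_update_eq θ k x,
      smul_comm (K.anchor (Y k) f)]
  have h1 : ∀ j : Fin (m + 1),
      ∑ k, θ (Function.update (Fin.cons (f • x) (j.removeNth Y) : Fin (m + 1) → A) k
        (K.br (Y j) ((Fin.cons (f • x) (j.removeNth Y) : Fin (m + 1) → A) k)))
      = f • (∑ k, θ (Function.update (Fin.cons x (j.removeNth Y) : Fin (m + 1) → A) k
        (K.br (Y j) ((Fin.cons x (j.removeNth Y) : Fin (m + 1) → A) k))))
        + K.anchor (Y j) f • θ (Fin.cons x (j.removeNth Y)) := by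
    intro j
    simp only [Fin.sum_univ_succ (n := m), Fin.cons_zero, Fin.cons_succ, Fin.update_cons_zero,
      ← Fin.cons_update, map_cons_add, map_cons_smul, K.br_smul, smul_add, Finset.smul_sum]
    abel
  simp only [brSum, Fin.sum_univ_succ (n := m + 1), Fin.cons_zero, Fin.cons_succ,
    Fin.removeNth_zero, Fin.tail_cons, removeNth_succ_cons, h0, h1]
  simp only [Fin.val_succ, pow_succ, Fin.val_zero, pow_zero, one_smul, mul_neg, mul_one, neg_smul,
    Finset.sum_neg_distrib, smul_add, Finset.sum_add_distrib, Finset.smul_sum, smul_neg, two_smul,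
    smul_comm f]
  abel

lemma dField_smul_zero [CharZero 𝕜] {q : ℕ} (θ : A [⋀^Fin q]→ₗ[R] W) (f : R) (x : A)
    (Y : Fin q → A) :
    K.dField θ (Fin.cons (f • x) Y) = f • K.dField θ (Fin.cons x Y) := by
  rw [dField_apply, dField_apply]
  cases q with
  | zero =>
    simp [actSum, brSum, K.act_smul_left]
  | succ m =>
    rw [actSum_smul, brSum_smul, smul_sub (2⁻¹ : 𝕜), smul_smul (2⁻¹ : 𝕜),
      inv_mul_cancel₀ two_ne_zero, one_smul, smul_sub f, smul_comm f (2⁻¹ : 𝕜)]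
    abel

lemma dField_smul [CharZero 𝕜] {q : ℕ} (θ : A [⋀^Fin q]→ₗ[R] W) (X : Fin (q + 1) → A)
    (i : Fin (q + 1)) (f : R) (x : A) :
    K.dField θ (Function.update X i (f • x)) = f • K.dField θ (Function.update X i x) := by
  rw [← Fin.insertNth_removeNth, ← Fin.insertNth_removeNth]
  erw [AlternatingMap.map_insertNth, AlternatingMap.map_insertNth, K.dField_smul_zero, smul_comm f]
  rfl

/-- The Koszul differential
`(dθ)(X₀, …, X_q) = ∑ᵢ (-1)ⁱ Xᵢ · θ(…, X̂ᵢ, …) + ∑_{i<j} (-1)^{i+j} θ([Xᵢ, Xⱼ], …, X̂ᵢ, …, X̂ⱼ, …)`.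
In the second sum, `[Xᵢ, Xⱼ]` is moved to the place of `Xⱼ`; the sum then runs over all ordered
pairs `i ≠ j`, so that each unordered pair occurs twice, whence the factor `1/2` (and the sign). -/
def d [CharZero 𝕜] {q : ℕ} (θ : A [⋀^Fin q]→ₗ[R] W) : A [⋀^Fin (q + 1)]→ₗ[R] W where
  toFun X := ∑ i : Fin (q + 1), (-1) ^ (i : ℕ) • K.act (X i) (θ (i.removeNth X))
    - (2⁻¹ : 𝕜) • ∑ i : Fin (q + 1), (-1) ^ (i : ℕ) •
        ∑ k, θ (Function.update (i.removeNth X) k (K.br (X i) (i.removeNth X k)))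
  map_update_add' {hd} X i x y := by
    cases Subsingleton.elim hd (instDecidableEqFin (q + 1))
    simpa only [dField_apply, actSum, brSum] using (K.dField θ).map_update_add X i x y
  map_update_smul' {hd} X i f x := by
    cases Subsingleton.elim hd (instDecidableEqFin (q + 1))
    simpa only [dField_apply, actSum, brSum] using K.dField_smul θ X i f x
  map_eq_zero_of_eq' X i j h hij := by
    simpa only [dField_apply, actSum, brSum] using (K.dField θ).map_eq_zero_of_eq X h hij


end KoszulDatum

/-! ### Forms on a Lie algebroid with values in its kernel

A Lie algebroid is a Lie-Rinehart algebra `A` over `R = C^∞(M)` (which is finitely generated and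
projective as a module); `⁅X, f⁆` is the derivative of `f` along the anchor of `X`. -/

section forms

variable (𝕜 R A : Type*) [Field 𝕜] [CommRing R] [Algebra 𝕜 R]
  [LieRing A] [LieAlgebra 𝕜 A] [Module R A] [LieRingModule A R] [LieRinehartRing R A]
  [LieRinehartAlgebra 𝕜 R A]

/-- The kernel `L` of the anchor. -/
def kernel : Submodule R A where
  carrier := {X | LieRinehartAlgebra.anchor 𝕜 R A X = 0}
  add_mem' {X Y} hX hY := by
    have hX' : LieRinehartAlgebra.anchor 𝕜 R A X = 0 := hX
    have hY' : LieRinehartAlgebra.anchor 𝕜 R A Y = 0 := hY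
    simp [hX', hY']
  zero_mem' := by simp
  smul_mem' f X hX := by
    have hX' : LieRinehartAlgebra.anchor 𝕜 R A X = 0 := hX
    have := (LieRinehartAlgebra.anchor 𝕜 R A).map_smul_apply f X
    simp only [hX', smul_zero] at this
    exact this

variable {𝕜 R A}

lemma mem_kernel {X : A} : X ∈ kernel 𝕜 R A ↔ ∀ f : R, ⁅X, f⁆ = 0 := by
  constructor
  · intro h f
    have h' : LieRinehartAlgebra.anchor 𝕜 R A X = 0 := h
    rw [← LieRinehartAlgebra.anchor_apply (R := 𝕜), h']
    rfl
  · intro h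
    change LieRinehartAlgebra.anchor 𝕜 R A X = 0
    ext f
    exact h f

lemma lie_mem_kernel (X : A) {ℓ : A} (h : ℓ ∈ kernel 𝕜 R A) : ⁅X, ℓ⁆ ∈ kernel 𝕜 R A := by
  rw [mem_kernel] at h ⊢
  intro f
  rw [lie_lie, h, h, lie_zero, sub_zero]

variable (𝕜 R A) in
/-- The adjoint representation `X · ℓ = [X, ℓ]` of `A` on its kernel. -/
def adjointDatum : KoszulDatum 𝕜 R A (kernel 𝕜 R A) where
  anchor X := LieRinehartAlgebra.anchor 𝕜 R A X
  br := LinearMap.mk₂ 𝕜 (fun X Y => ⁅X, Y⁆) add_lie smul_lie lie_add (fun c X Y => lie_smul c X Y)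
  act := LinearMap.mk₂ 𝕜 (fun X ℓ => ⟨⁅X, (ℓ : A)⁆, lie_mem_kernel X ℓ.2⟩)
    (fun _ _ _ => Subtype.ext (add_lie _ _ _)) (fun _ _ _ => Subtype.ext (smul_lie _ _ _))
    (fun _ _ _ => Subtype.ext (lie_add _ _ _)) (fun _ _ _ => Subtype.ext (lie_smul _ _ _))
  br_self X := lie_self X
  br_smul X Y f := LieRinehartRing.leibniz_smul_right X Y f
  act_smul_left f X ℓ := Subtype.ext <| by
    change ⁅f • X, (ℓ : A)⁆ = f • ⁅X, (ℓ : A)⁆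
    rw [← lie_skew, LieRinehartRing.leibniz_smul_right, mem_kernel.1 ℓ.2, zero_smul, add_zero,
      ← smul_neg, lie_skew]
  act_smul X f ℓ := Subtype.ext (LieRinehartRing.leibniz_smul_right X (ℓ : A) f)

variable (𝕜 R A) in
/-- `Ω^q(A, L)`: the `R`-multilinear alternating maps `A^q → L`, where `L` is the kernel of `A`. -/
abbrev KForm (q : ℕ) := A [⋀^Fin q]→ₗ[R] kernel 𝕜 R A

/-- The differential `d̂` of `Ω^•(A, L)`, for the adjoint representation of `A` on `L`. -/
def dHat [CharZero 𝕜] {q : ℕ} (θ : KForm 𝕜 R A q) : KForm 𝕜 R A (q + 1) :=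
  (adjointDatum 𝕜 R A).d θ

end forms

/-! ### The trivial Lie algebroid and its forms -/

section trivial

variable (𝕜 R g : Type*) [Field 𝕜] [CommRing R] [Algebra 𝕜 R] [LieRing g] [LieAlgebra 𝕜 g]

/-- The trivial Lie algebroid `TLA(U, g) = Γ(TU) ⊕ Γ(U × g)`, with `R = C^∞(U)`, `Γ(TU)` the
derivations of `R` and `Γ(U × g) = R ⊗ g`. -/
abbrev TLA := Derivation 𝕜 R R × (R ⊗[𝕜] g)

variable {𝕜 R} in
/-- The derivative `X · γ` of a `g`-valued function `γ ∈ R ⊗ g` along the vector field `X`. -/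
def derAct (X : Derivation 𝕜 R R) : R ⊗[𝕜] g →ₗ[𝕜] R ⊗[𝕜] g :=
  LinearMap.rTensor g (X : R →ₗ[𝕜] R)

variable {𝕜 R g}

@[simp] lemma derAct_tmul (X : Derivation 𝕜 R R) (f : R) (v : g) :
    derAct g X (f ⊗ₜ v) = X f ⊗ₜ v := rfl

lemma derAct_add_left (X Y : Derivation 𝕜 R R) (γ : R ⊗[𝕜] g) :
    derAct g (X + Y) γ = derAct g X γ + derAct g Y γ := by
  induction γ with
  | zero => simp
  | tmul f v => simp [TensorProduct.add_tmul]
  | add γ η h1 h2 => simp only [map_add, h1, h2]; abel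

lemma derAct_smul_left (c : 𝕜) (X : Derivation 𝕜 R R) (γ : R ⊗[𝕜] g) :
    derAct g (c • X) γ = c • derAct g X γ := by
  induction γ with
  | zero => simp
  | tmul f v => simp [TensorProduct.smul_tmul']
  | add γ η h1 h2 => simp only [map_add, h1, h2, smul_add]

lemma derAct_fsmul_left (f : R) (X : Derivation 𝕜 R R) (γ : R ⊗[𝕜] g) :
    derAct g (f • X) γ = f • derAct g X γ := by
  induction γ with
  | zero => simp
  | tmul f v => simp [TensorProduct.smul_tmul']
  | add γ η h1 h2 => simp only [map_add, h1, h2, smul_add]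

lemma derAct_fsmul (f : R) (X : Derivation 𝕜 R R) (γ : R ⊗[𝕜] g) :
    derAct g X (f • γ) = f • derAct g X γ + X f • γ := by
  induction γ with
  | zero => simp
  | tmul h v => simp [TensorProduct.smul_tmul', TensorProduct.add_tmul, mul_comm h]
  | add γ η h1 h2 => simp only [map_add, h1, h2, smul_add]; abel

variable (𝕜 R g) in
/-- The part of the structure of `TLA` that does not involve the bracket of `g`: the anchor
`X ⊕ γ ↦ X`, the bracket `[X, Y] ⊕ (X · η - Y · γ)` and the action `X · η` of `X ⊕ γ` on `η`. Its
Koszul differential is the de Rham differential on `Ω^•(U) ⊗ Λ^• g* ⊗ g`. -/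
def deRhamDatum : KoszulDatum 𝕜 R (TLA 𝕜 R g) (R ⊗[𝕜] g) where
  anchor X := X.1
  br := LinearMap.mk₂ 𝕜 (fun X Y => (⁅X.1, Y.1⁆, derAct g X.1 Y.2 - derAct g Y.1 X.2))
    (fun X Y Z => by ext1 <;> simp [derAct_add_left]; abel)
    (fun c X Y => by ext1 <;> simp [derAct_smul_left, smul_sub])
    (fun X Y Z => by ext1 <;> simp [derAct_add_left]; abel)
    (fun c X Y => by ext1 <;> simp [derAct_smul_left, smul_sub])
  act := LinearMap.mk₂ 𝕜 (fun X η => derAct g X.1 η)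
    (fun X Y η => by simp [derAct_add_left]) (fun c X η => by simp [derAct_smul_left])
    (fun X η θ => by simp) (fun c X η => by simp)
  br_self X := by simp
  br_smul X Y f := by
    ext1
    · simp
    · simp [derAct_fsmul, derAct_fsmul_left, smul_sub]; abel
  act_smul_left f X w := by simp [derAct_fsmul_left]
  act_smul X f w := by simp [derAct_fsmul]

variable (𝕜 R g) in
/-- The part of the structure of `TLA` that comes from the bracket of `g`: the bracket
`0 ⊕ [γ, η]` and the adjoint action `[γ, η]` of `X ⊕ γ` on `η`. Its Koszul differential is the
Chevalley-Eilenberg differential on `Ω^•(U) ⊗ Λ^• g* ⊗ g` for the adjoint representation. -/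
def chevalleyEilenbergDatum : KoszulDatum 𝕜 R (TLA 𝕜 R g) (R ⊗[𝕜] g) where
  anchor _ := 0
  br := LinearMap.mk₂ 𝕜 (fun X Y => (0, ⁅X.2, Y.2⁆))
    (fun X Y Z => by ext1 <;> simp) (fun c X Y => by ext1 <;> simp)
    (fun X Y Z => by ext1 <;> simp) (fun c X Y => by ext1 <;> simp)
  act := LinearMap.mk₂ 𝕜 (fun X η => ⁅X.2, η⁆)
    (fun X Y η => by simp) (fun c X η => by simp)
    (fun X η θ => by simp) (fun c X η => by simp)
  br_self X := by simp
  br_smul X Y f := by ext1 <;> simp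
  act_smul_left f X w := by simp
  act_smul X f w := by simp

variable (𝕜 R g) in
/-- `Ω^q_TLA(U, g)`: the `C^∞(U)`-multilinear alternating maps `TLA(U, g)^q → Γ(U × g)`, i.e. the
part of total degree `q` of `Ω^•(U) ⊗ Λ^• g* ⊗ g`. -/
abbrev TLAForm (q : ℕ) := TLA 𝕜 R g [⋀^Fin q]→ₗ[R] R ⊗[𝕜] g

/-- The de Rham differential `d` on `Ω^•_TLA(U, g)`. -/
def dDeRham [CharZero 𝕜] {q : ℕ} (θ : TLAForm 𝕜 R g q) :
    TLAForm 𝕜 R g (q + 1) :=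
  (deRhamDatum 𝕜 R g).d θ

/-- The Chevalley-Eilenberg differential `s'` on `Ω^•_TLA(U, g)`. -/
def sPrime [CharZero 𝕜] {q : ℕ} (θ : TLAForm 𝕜 R g q) :
    TLAForm 𝕜 R g (q + 1) :=
  (chevalleyEilenbergDatum 𝕜 R g).d θ

/-- The differential `d_TLA = d + s'` of `Ω^•_TLA(U, g)`. The two brackets above add up to
`[X ⊕ γ, Y ⊕ η] = [X, Y] ⊕ (X · η - Y · γ + [γ, η])`. -/
def dTLA [CharZero 𝕜] {q : ℕ} (θ : TLAForm 𝕜 R g q) :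
    TLAForm 𝕜 R g (q + 1) :=
  dDeRham θ + sPrime θ

/-- The graded Lie bracket `[θ, η](Y₁, …) = ∑ sgn(σ) [θ(Y_{σ(1)}, …), η(Y_{σ(p+1)}, …)]` of
`Ω^•_TLA(U, g)`; the sum runs over the `(p, q)`-shuffles `σ`. -/
def formBracket {p q : ℕ} (θ : TLAForm 𝕜 R g p) (η : TLAForm 𝕜 R g q) :
    TLAForm 𝕜 R g (p + q) :=
  ((TensorProduct.lift (LinearMap.mk₂ R (fun γ δ : R ⊗[𝕜] g => ⁅γ, δ⁆) add_lie smul_lie lie_add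
      fun f γ δ => lie_smul f γ δ)).compAlternatingMap
    (θ.domCoprod η)).domDomCongr finSumFinEquiv

variable (𝕜 R g) in
/-- The family `φ` of maps is an isomorphism of the graded differential Lie algebra
`Ω^•_TLA(U, g)` onto itself. -/
structure IsGradedDiffLieIso [CharZero 𝕜]
    (φ : ∀ q : ℕ, TLAForm 𝕜 R g q →ₗ[R] TLAForm 𝕜 R g q) : Prop where
  bijective : ∀ q, Function.Bijective (φ q)
  map_bracket : ∀ (p q : ℕ) (θ : TLAForm 𝕜 R g p) (η : TLAForm 𝕜 R g q),
    φ (p + q) (formBracket θ η) = formBracket (φ p θ) (φ q η)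
  map_d : ∀ (q : ℕ) (θ : TLAForm 𝕜 R g q), φ (q + 1) (dTLA θ) = dTLA (φ q θ)

end trivial

/-! ### Smooth functions and vector fields on a manifold and on its open subsets -/

/-- The algebra of smooth `𝕜`-valued functions on the manifold `N`, where `𝕜` is `ℝ` or `ℂ`. -/
def smoothFun (𝕜 E N : Type*) [RCLike 𝕜] [NormedAddCommGroup E] [NormedSpace ℝ E]
    [TopologicalSpace N] [ChartedSpace E N] : Subalgebra 𝕜 (N → 𝕜) where
  carrier := {f | ContMDiff 𝓘(ℝ, E) 𝓘(ℝ, 𝕜) ∞ f}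
  mul_mem' {f g} hf hg := by
    have : ContDiff ℝ ∞ (fun p : 𝕜 × 𝕜 => p.1 * p.2) := contDiff_mul
    exact this.contMDiff.comp (hf.prodMk_space hg)
  add_mem' {f g} hf hg := ContMDiff.add hf hg
  algebraMap_mem' c := contMDiff_const

/-- `C^∞(N)`, with values in `𝕜`. -/
def SmoothFun (𝕜 E N : Type*) [RCLike 𝕜] [NormedAddCommGroup E] [NormedSpace ℝ E]
    [TopologicalSpace N] [ChartedSpace E N] : Type _ := ↥(smoothFun 𝕜 E N)

namespace SmoothFun
variable {𝕜 E N : Type*} [RCLike 𝕜] [NormedAddCommGroup E] [NormedSpace ℝ E]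
    [TopologicalSpace N] [ChartedSpace E N]

instance : CommRing (SmoothFun 𝕜 E N) := inferInstanceAs (CommRing ↥(smoothFun 𝕜 E N))
instance : Algebra 𝕜 (SmoothFun 𝕜 E N) := inferInstanceAs (Algebra 𝕜 ↥(smoothFun 𝕜 E N))
instance : FunLike (SmoothFun 𝕜 E N) N 𝕜 where
  coe f := f.1
  coe_injective _ _ h := Subtype.ext h

/-- Bundle a smooth function. -/
def mk (f : N → 𝕜) (hf : ContMDiff 𝓘(ℝ, E) 𝓘(ℝ, 𝕜) ∞ f) : SmoothFun 𝕜 E N := ⟨f, hf⟩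

protected lemma contMDiff (f : SmoothFun 𝕜 E N) : ContMDiff 𝓘(ℝ, E) 𝓘(ℝ, 𝕜) ∞ f := f.2

@[simp] lemma mk_apply (f : N → 𝕜) (hf : ContMDiff 𝓘(ℝ, E) 𝓘(ℝ, 𝕜) ∞ f) (x : N) :
    (mk f hf : SmoothFun 𝕜 E N) x = f x := rfl

@[ext] lemma ext {f g : SmoothFun 𝕜 E N} (h : ∀ x, f x = g x) : f = g := DFunLike.ext f g h
@[simp] lemma add_apply (f g : SmoothFun 𝕜 E N) (x : N) : (f + g) x = f x + g x := rfl
@[simp] lemma sub_apply (f g : SmoothFun 𝕜 E N) (x : N) : (f - g) x = f x - g x := rfl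
@[simp] lemma neg_apply (f : SmoothFun 𝕜 E N) (x : N) : (-f) x = -f x := rfl
@[simp] lemma mul_apply (f g : SmoothFun 𝕜 E N) (x : N) : (f * g) x = f x * g x := rfl
@[simp] lemma zero_apply (x : N) : (0 : SmoothFun 𝕜 E N) x = 0 := rfl
@[simp] lemma one_apply (x : N) : (1 : SmoothFun 𝕜 E N) x = 1 := rfl
@[simp] lemma smul_apply (c : 𝕜) (f : SmoothFun 𝕜 E N) (x : N) : (c • f) x = c * f x := rfl
@[simp] lemma algebraMap_apply (c : 𝕜) (x : N) : algebraMap 𝕜 (SmoothFun 𝕜 E N) c x = c := rfl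
end SmoothFun

section basic
variable {𝕜 E N : Type*} [RCLike 𝕜] [NormedAddCommGroup E] [NormedSpace ℝ E]
    [TopologicalSpace N] [ChartedSpace E N] 

/-- The restriction of functions to an open subset. -/
def SmoothFun.restrict (V : Opens N) : SmoothFun 𝕜 E N →ₐ[𝕜] SmoothFun 𝕜 E V where
  toFun f := mk (fun x => f x) (f.contMDiff.comp contMDiff_subtype_val)
  map_one' := rfl
  map_mul' _ _ := rfl
  map_zero' := rfl
  map_add' _ _ := rfl
  commutes' _ := rfl

/-- The restriction of functions from an open subset to a smaller one. -/
def SmoothFun.res {V U : Opens N} (h : V ≤ U) : SmoothFun 𝕜 E U →ₐ[𝕜] SmoothFun 𝕜 E V where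
  toFun f := mk (fun x => f ⟨x, h x.2⟩) (f.contMDiff.comp (contMDiff_inclusion h))
  map_one' := rfl
  map_mul' _ _ := rfl
  map_zero' := rfl
  map_add' _ _ := rfl
  commutes' _ := rfl

variable [FiniteDimensional ℝ E] [IsManifold 𝓘(ℝ, E) ∞ N] [T2Space N]

lemma exists_bump (x : N) {W : Set N} (hW : W ∈ 𝓝 x) :
    ∃ φ : SmoothFun 𝕜 E N, (∀ᶠ y in 𝓝 x, φ y = 1) ∧ tsupport φ ⊆ W := by
  obtain ⟨f, -, hf⟩ := (SmoothBumpFunction.nhds_basis_tsupport (I := 𝓘(ℝ, E)) x).mem_iff.1 hW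
  have hc : ContDiff ℝ ∞ (fun r : ℝ => (r : 𝕜)) := (RCLike.ofRealCLM (K := 𝕜)).contDiff
  refine ⟨SmoothFun.mk (fun y => ((f y : ℝ) : 𝕜)) (hc.contMDiff.comp f.contMDiff), ?_, ?_⟩
  · filter_upwards [f.eventuallyEq_one] with y hy
    simp [hy]
  · refine (closure_mono ?_).trans hf
    intro y hy
    simp only [Function.mem_support, SmoothFun.mk_apply, ne_eq, RCLike.ofReal_eq_zero] at hy ⊢
    exact hy

lemma smoothFun_of_local {f : N → 𝕜}
    (h : ∀ x, ∃ g : SmoothFun 𝕜 E N, ∀ᶠ y in 𝓝 x, f y = g y) : ContMDiff 𝓘(ℝ, E) 𝓘(ℝ, 𝕜) ∞ f := by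
  intro x
  obtain ⟨g, hg⟩ := h x
  exact g.contMDiff.contMDiffAt.congr_of_eventuallyEq hg

open Classical in
/-- The product `φ f`, extended by zero outside `V`. -/
def zeroExt (V : Opens N) (φ : SmoothFun 𝕜 E N) (hφ : tsupport φ ⊆ V) (f : SmoothFun 𝕜 E V) :
    SmoothFun 𝕜 E N :=
  SmoothFun.mk (fun y => φ y * (if h : y ∈ V then f ⟨y, h⟩ else 0)) <| by
    let f' : N → 𝕜 := fun y => if h : y ∈ V then f ⟨y, h⟩ else 0
    have hf' : ∀ y : V, f' y = f y := fun y => by simp [f', y.2]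
    change ContMDiff 𝓘(ℝ, E) 𝓘(ℝ, 𝕜) ∞ (fun y => φ y * f' y)
    intro y
    by_cases hy : y ∈ V
    · have h3 : ContMDiffAt 𝓘(ℝ, E) 𝓘(ℝ, 𝕜) ∞ f' y := by
        have := (contMDiffAt_subtype_iff (I := 𝓘(ℝ, E)) (I' := 𝓘(ℝ, 𝕜)) (n := ∞) (f := f')
          (x := (⟨y, hy⟩ : V))).1
        apply this
        rw [show (fun x : V => f' x) = ⇑f from funext hf']
        exact f.contMDiff.contMDiffAt
      have : ContDiff ℝ ∞ (fun p : 𝕜 × 𝕜 => p.1 * p.2) := contDiff_mul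
      exact this.contMDiff.contMDiffAt.comp y (φ.contMDiff.contMDiffAt.prodMk_space h3)
    · have : (fun y => φ y * f' y) =ᶠ[𝓝 y] fun _ => 0 := by
        have : y ∉ tsupport φ := fun h => hy (hφ h)
        filter_upwards [(notMem_tsupport_iff_eventuallyEq (f := ⇑φ)).1 this] with z hz
        simp [hz]
      exact contMDiffAt_const.congr_of_eventuallyEq this

lemma zeroExt_apply (V : Opens N) (φ : SmoothFun 𝕜 E N) (hφ : tsupport φ ⊆ V)
    (f : SmoothFun 𝕜 E V) (y : V) : zeroExt V φ hφ f y = φ y * f y := by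
  simp only [zeroExt, SmoothFun.mk_apply, y.2, dif_pos]

lemma zeroExt_apply_of_notMem (V : Opens N) (φ : SmoothFun 𝕜 E N) (hφ : tsupport φ ⊆ V)
    (f : SmoothFun 𝕜 E V) {y : N} (hy : y ∉ V) : zeroExt V φ hφ f y = 0 := by
  simp only [zeroExt, SmoothFun.mk_apply, hy, dif_neg, not_false_eq_true, mul_zero]

/-- Every smooth function on an open set agrees near a given point with a global one. -/
lemma exists_ext (V : Opens N) (f : SmoothFun 𝕜 E V) (x : V) :
    ∃ F : SmoothFun 𝕜 E N, ∀ᶠ y in 𝓝 x, f y = F y := by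
  obtain ⟨φ, h1, h2⟩ := exists_bump (𝕜 := 𝕜) (E := E) (x : N) (V.isOpen.mem_nhds x.2)
  refine ⟨zeroExt V φ h2 f, ?_⟩
  filter_upwards [continuous_subtype_val.continuousAt.eventually h1] with y hy
  rw [zeroExt_apply, hy, one_mul]

lemma der_local (D : Derivation 𝕜 (SmoothFun 𝕜 E N) (SmoothFun 𝕜 E N)) (x : N)
    {f g : SmoothFun 𝕜 E N} (h : ∀ᶠ y in 𝓝 x, f y = g y) : D f x = D g x := by
  obtain ⟨φ, h1, h2⟩ := exists_bump (𝕜 := 𝕜) (E := E) x h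
  have h0 : φ * (f - g) = 0 := by
    ext y
    by_cases hy : f y = g y
    · change φ y * (f y - g y) = 0
      simp [hy]
    · have : φ y = 0 := image_eq_zero_of_notMem_tsupport (f := ⇑φ) fun hh => hy (h2 hh)
      change φ y * (f y - g y) = 0
      simp [this]
  have h3 := congrArg (fun u => (D u) x) h0
  simp only [Derivation.leibniz, map_sub, map_zero] at h3
  have h4 : φ x * (D f x - D g x) + (f x - g x) * (D φ) x = 0 := h3
  rw [h1.self_of_nhds, h.self_of_nhds] at h4
  simpa [sub_eq_zero] using h4

/-- The restriction of a vector field (a derivation of `C^∞(N)`) to an open set. -/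
def restrictDer (V : Opens N) (D : Derivation 𝕜 (SmoothFun 𝕜 E N) (SmoothFun 𝕜 E N)) :
    Derivation 𝕜 (SmoothFun 𝕜 E V) (SmoothFun 𝕜 E V) :=
  have key : ∀ (f : SmoothFun 𝕜 E V) (F : SmoothFun 𝕜 E N) (x : V), (∀ᶠ y in 𝓝 x, f y = F y) →
      D (exists_ext V f x).choose x = D F x := fun f F x h => by
    refine der_local D x ?_
    rw [← V.isOpen.isOpenEmbedding_subtypeVal.map_nhds_eq, eventually_map]
    filter_upwards [h, (exists_ext V f x).choose_spec] with y h1 h2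
    rw [← h1, ← h2]
  let T : SmoothFun 𝕜 E V → SmoothFun 𝕜 E V := fun f =>
    SmoothFun.mk (fun x => D (exists_ext V f x).choose x) <| smoothFun_of_local fun x =>
      ⟨SmoothFun.restrict V (D (exists_ext V f x).choose), by
        filter_upwards [eventually_eventually_nhds.2 (exists_ext V f x).choose_spec] with y hy
        exact key f _ y hy⟩
  have hT : ∀ (f : SmoothFun 𝕜 E V) (F : SmoothFun 𝕜 E N) (x : V), (∀ᶠ y in 𝓝 x, f y = F y) →
      T f x = D F x := key
  Derivation.mk'
    { toFun := T
      map_add' := fun f h => by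
        ext x
        obtain ⟨F, hF⟩ := exists_ext V f x
        obtain ⟨H, hH⟩ := exists_ext V h x
        rw [SmoothFun.add_apply, hT f F x hF, hT h H x hH, hT (f + h) (F + H) x, map_add,
          SmoothFun.add_apply]
        filter_upwards [hF, hH] with y h1 h2
        rw [SmoothFun.add_apply, SmoothFun.add_apply, h1, h2]
      map_smul' := fun c f => by
        ext x
        obtain ⟨F, hF⟩ := exists_ext V f x
        rw [RingHom.id_apply, SmoothFun.smul_apply, hT f F x hF, hT (c • f) (c • F) x, D.map_smul,
          SmoothFun.smul_apply]
        filter_upwards [hF] with y h1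
        rw [SmoothFun.smul_apply, SmoothFun.smul_apply, h1] }
    fun f h => by
      ext x
      obtain ⟨F, hF⟩ := exists_ext V f x
      obtain ⟨H, hH⟩ := exists_ext V h x
      have hFH : ∀ᶠ y in 𝓝 x, (f * h) y = (F * H : SmoothFun 𝕜 E N) y := by
        filter_upwards [hF, hH] with y h1 h2
        rw [SmoothFun.mul_apply, SmoothFun.mul_apply, h1, h2]
      change T (f * h) x = (f * T h + h * T f) x
      rw [hT (f * h) (F * H) x hFH, Derivation.leibniz]
      simp only [smul_eq_mul, SmoothFun.add_apply, SmoothFun.mul_apply]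
      rw [hT f F x hF, hT h H x hH, hF.self_of_nhds, hH.self_of_nhds]

lemma restrictDer_apply {V : Opens N} (D : Derivation 𝕜 (SmoothFun 𝕜 E N) (SmoothFun 𝕜 E N))
    {f : SmoothFun 𝕜 E V} {F : SmoothFun 𝕜 E N} {x : V} (h : ∀ᶠ y in 𝓝 x, f y = F y) :
    restrictDer V D f x = D F x := by
  change D (exists_ext V f x).choose x = D F x
  refine der_local D x ?_
  rw [← V.isOpen.isOpenEmbedding_subtypeVal.map_nhds_eq, eventually_map]
  filter_upwards [h, (exists_ext V f x).choose_spec] with y h1 h2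
  rw [← h1, ← h2]

lemma restrictDer_restrict {V : Opens N}
    (D : Derivation 𝕜 (SmoothFun 𝕜 E N) (SmoothFun 𝕜 E N)) (F : SmoothFun 𝕜 E N) :
    restrictDer V D (SmoothFun.restrict V F) = SmoothFun.restrict V (D F) := by
  ext x
  exact restrictDer_apply D (Eventually.of_forall fun _ => rfl)

lemma restrictDer_add {V : Opens N} (D D' : Derivation 𝕜 (SmoothFun 𝕜 E N) (SmoothFun 𝕜 E N)) :
    restrictDer V (D + D') = restrictDer V D + restrictDer V D' := by
  ext f x
  obtain ⟨F, hF⟩ := exists_ext V f x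
  simp only [Derivation.add_apply, SmoothFun.add_apply, restrictDer_apply _ hF]

lemma restrictDer_smul {V : Opens N} (φ : SmoothFun 𝕜 E N)
    (D : Derivation 𝕜 (SmoothFun 𝕜 E N) (SmoothFun 𝕜 E N)) :
    restrictDer V (φ • D) = SmoothFun.restrict V φ • restrictDer V D := by
  ext f x
  obtain ⟨F, hF⟩ := exists_ext V f x
  simp only [Derivation.smul_apply, smul_eq_mul, SmoothFun.mul_apply, restrictDer_apply _ hF]
  rfl

lemma restrictDer_lie {V : Opens N} (D D' : Derivation 𝕜 (SmoothFun 𝕜 E N) (SmoothFun 𝕜 E N)) :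
    restrictDer V ⁅D, D'⁆ = ⁅restrictDer V D, restrictDer V D'⁆ := by
  ext f x
  obtain ⟨F, hF⟩ := exists_ext V f x
  have h : ∀ D : Derivation 𝕜 (SmoothFun 𝕜 E N) (SmoothFun 𝕜 E N),
      ∀ᶠ y in 𝓝 x, restrictDer V D f y = D F y := fun D => by
    filter_upwards [eventually_eventually_nhds.2 hF] with y hy using restrictDer_apply D hy
  simp only [Derivation.commutator_apply, SmoothFun.sub_apply, restrictDer_apply _ hF,
    restrictDer_apply _ (h _)]

/-- The vector field `X` on `V` agrees near `x` with the global vector field `D`. -/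
def DerNear {V : Opens N} (X : Derivation 𝕜 (SmoothFun 𝕜 E V) (SmoothFun 𝕜 E V))
    (D : Derivation 𝕜 (SmoothFun 𝕜 E N) (SmoothFun 𝕜 E N)) (x : V) : Prop :=
  ∀ᶠ y in 𝓝 x, ∀ F, X (SmoothFun.restrict V F) y = D F y

lemma exists_derNear {V : Opens N} (X : Derivation 𝕜 (SmoothFun 𝕜 E V) (SmoothFun 𝕜 E V))
    (x : V) : ∃ D : Derivation 𝕜 (SmoothFun 𝕜 E N) (SmoothFun 𝕜 E N), DerNear X D x := by
  obtain ⟨φ, h1, h2⟩ := exists_bump (𝕜 := 𝕜) (E := E) (x : N) (V.isOpen.mem_nhds x.2)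
  refine ⟨Derivation.mk'
    { toFun := fun F => zeroExt V φ h2 (X (SmoothFun.restrict V F))
      map_add' := fun F G => ?_
      map_smul' := fun c F => ?_ } fun F G => ?_, ?_⟩
  · ext y
    by_cases hy : y ∈ V
    · lift y to V using hy
      simp only [SmoothFun.add_apply, zeroExt_apply, map_add, mul_add]
    · simp only [SmoothFun.add_apply, zeroExt_apply_of_notMem _ _ _ _ hy, add_zero]
  · ext y
    by_cases hy : y ∈ V
    · lift y to V using hy
      simp only [SmoothFun.smul_apply, zeroExt_apply, map_smul, X.map_smul, RingHom.id_apply]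
      ring
    · simp only [SmoothFun.smul_apply, zeroExt_apply_of_notMem _ _ _ _ hy, mul_zero,
        RingHom.id_apply]
  · ext y
    by_cases hy : y ∈ V
    · lift y to V using hy
      simp only [LinearMap.coe_mk, AddHom.coe_mk, SmoothFun.add_apply, smul_eq_mul,
        SmoothFun.mul_apply, zeroExt_apply, map_mul, Derivation.leibniz]
      have : ∀ H : SmoothFun 𝕜 E N, SmoothFun.restrict V H y = H y := fun _ => rfl
      rw [this, this]
      ring
    · simp only [LinearMap.coe_mk, AddHom.coe_mk, SmoothFun.add_apply, smul_eq_mul,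
        SmoothFun.mul_apply, zeroExt_apply_of_notMem _ _ _ _ hy, mul_zero, add_zero]
  · filter_upwards [continuous_subtype_val.continuousAt.eventually h1] with y hy F
    change _ = zeroExt V φ h2 (X (SmoothFun.restrict V F)) y
    rw [zeroExt_apply, hy, one_mul]

lemma DerNear.apply {V : Opens N} {X : Derivation 𝕜 (SmoothFun 𝕜 E V) (SmoothFun 𝕜 E V)}
    {D : Derivation 𝕜 (SmoothFun 𝕜 E N) (SmoothFun 𝕜 E N)} {x : V} (h : DerNear X D x)
    {f : SmoothFun 𝕜 E V} {F : SmoothFun 𝕜 E N} (hf : ∀ᶠ y in 𝓝 x, f y = F y) :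
    X f x = D F x := by
  rw [← h.self_of_nhds F]
  exact der_local X x hf

lemma DerNear.eventually {V : Opens N} {X : Derivation 𝕜 (SmoothFun 𝕜 E V) (SmoothFun 𝕜 E V)}
    {D : Derivation 𝕜 (SmoothFun 𝕜 E N) (SmoothFun 𝕜 E N)} {x : V} (h : DerNear X D x) :
    ∀ᶠ y in 𝓝 x, DerNear X D y := eventually_eventually_nhds.2 h

lemma DerNear.add {V : Opens N} {X Y : Derivation 𝕜 (SmoothFun 𝕜 E V) (SmoothFun 𝕜 E V)}
    {D D' : Derivation 𝕜 (SmoothFun 𝕜 E N) (SmoothFun 𝕜 E N)} {x : V} (h : DerNear X D x)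
    (h' : DerNear Y D' x) : DerNear (X + Y) (D + D') x := by
  filter_upwards [h, h'] with y h1 h2 F
  simp only [Derivation.add_apply, SmoothFun.add_apply, h1, h2]

lemma DerNear.smul {V : Opens N} {X : Derivation 𝕜 (SmoothFun 𝕜 E V) (SmoothFun 𝕜 E V)}
    {D : Derivation 𝕜 (SmoothFun 𝕜 E N) (SmoothFun 𝕜 E N)} {x : V} (h : DerNear X D x)
    {f : SmoothFun 𝕜 E V} {F : SmoothFun 𝕜 E N} (hf : ∀ᶠ y in 𝓝 x, f y = F y) :
    DerNear (f • X) (F • D) x := by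
  filter_upwards [h, hf] with y h1 h2 G
  simp only [Derivation.smul_apply, smul_eq_mul, SmoothFun.mul_apply, h1, h2]

lemma DerNear.lie {V : Opens N} {X Y : Derivation 𝕜 (SmoothFun 𝕜 E V) (SmoothFun 𝕜 E V)}
    {D D' : Derivation 𝕜 (SmoothFun 𝕜 E N) (SmoothFun 𝕜 E N)} {x : V} (h : DerNear X D x)
    (h' : DerNear Y D' x) : DerNear ⁅X, Y⁆ ⁅D, D'⁆ x := by
  filter_upwards [h.eventually, h'.eventually] with y h1 h2 F
  have e1 : ∀ᶠ z in 𝓝 y, X (SmoothFun.restrict V F) z = D F z := by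
    filter_upwards [h1] with z hz using hz F
  have e2 : ∀ᶠ z in 𝓝 y, Y (SmoothFun.restrict V F) z = D' F z := by
    filter_upwards [h2] with z hz using hz F
  simp only [Derivation.commutator_apply, SmoothFun.sub_apply, h1.apply e2, h2.apply e1]

end basic

/-! ### Restriction of a Lie algebroid to an open subset

A finitely generated projective module `A` over `C^∞(M)` is the module of sections of a vector
bundle, with fibre `A / 𝔪ₓ A` at `x`, where `𝔪ₓ` is the ideal of the functions that vanish at `x`.
The module `A_V` of the sections of this bundle over an open subset `V` consists of the families of
elements of the fibres over `V` which near each point are given by an element of `A`. -/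

section sections

variable {𝕜 E M : Type*} [RCLike 𝕜] [NormedAddCommGroup E] [NormedSpace ℝ E]
    [TopologicalSpace M] [ChartedSpace E M] 

/-- The ideal `𝔪ₓ` of the functions that vanish at `x`. -/
def evalIdeal (𝕜 E : Type*) {M : Type*} [RCLike 𝕜] [NormedAddCommGroup E] [NormedSpace ℝ E]
    [TopologicalSpace M] [ChartedSpace E M] (x : M) : Ideal (SmoothFun 𝕜 E M) where
  carrier := {f | f x = 0}
  add_mem' {f g} hf hg := by
    have h1 : f x = 0 := hf
    have h2 : g x = 0 := hg
    simp [h1, h2]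
  zero_mem' := rfl
  smul_mem' c f hf := by
    have h1 : f x = 0 := hf
    simp [h1]

lemma mem_evalIdeal {x : M} {f : SmoothFun 𝕜 E M} : f ∈ evalIdeal 𝕜 E x ↔ f x = 0 := Iff.rfl

/-- The fibre `A / 𝔪ₓ A` at `x`. -/
def Fiber (𝕜 E A : Type*) {M : Type*} [RCLike 𝕜] [NormedAddCommGroup E] [NormedSpace ℝ E]
    [TopologicalSpace M] [ChartedSpace E M] [AddCommGroup A] [Module (SmoothFun 𝕜 E M) A]
    (x : M) : Type _ :=
  A ⧸ (evalIdeal 𝕜 E x • (⊤ : Submodule (SmoothFun 𝕜 E M) A))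

variable {A : Type*} [AddCommGroup A] [Module (SmoothFun 𝕜 E M) A]

instance (x : M) : AddCommGroup (Fiber 𝕜 E A x) :=
  inferInstanceAs (AddCommGroup (A ⧸ (evalIdeal 𝕜 E x • (⊤ : Submodule (SmoothFun 𝕜 E M) A))))

instance [Module 𝕜 A] [IsScalarTower 𝕜 (SmoothFun 𝕜 E M) A] (x : M) : Module 𝕜 (Fiber 𝕜 E A x) :=
  inferInstanceAs (Module 𝕜 (A ⧸ (evalIdeal 𝕜 E x • (⊤ : Submodule (SmoothFun 𝕜 E M) A))))

variable (𝕜 E) in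
/-- The value at `x` of an element of `A`. -/
def fval (x : M) : A →+ Fiber 𝕜 E A x :=
  (Submodule.mkQ (evalIdeal 𝕜 E x • (⊤ : Submodule (SmoothFun 𝕜 E M) A))).toAddMonoidHom

lemma fval_eq_zero_of_mem {x : M} {f : SmoothFun 𝕜 E M} (hf : f x = 0) (a : A) :
    fval 𝕜 E x (f • a) = 0 :=
  (Submodule.Quotient.mk_eq_zero _).2
    (Submodule.smul_mem_smul (mem_evalIdeal.2 hf) (Submodule.mem_top (x := a)))

variable [Module 𝕜 A] [IsScalarTower 𝕜 (SmoothFun 𝕜 E M) A]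

lemma fval_smul (x : M) (c : 𝕜) (b : A) : fval 𝕜 E x (c • b) = c • fval 𝕜 E x b := rfl

lemma fval_fsmul (x : M) (f : SmoothFun 𝕜 E M) (a : A) :
    fval 𝕜 E x (f • a) = f x • fval 𝕜 E x a := by
  have h : (f - algebraMap 𝕜 (SmoothFun 𝕜 E M) (f x)) x = 0 := by simp
  have := fval_eq_zero_of_mem h a
  rwa [sub_smul, algebraMap_smul, map_sub, sub_eq_zero, fval_smul] at this


variable (𝕜 E A) in
/-- The families of elements of the fibres over `V` that are locally given by elements of `A`. -/
def localSec (V : Opens M) [FiniteDimensional ℝ E] [IsManifold 𝓘(ℝ, E) ∞ M] [T2Space M] :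
    Submodule 𝕜 ((x : V) → Fiber 𝕜 E A (x : M)) where
  carrier := {s | ∀ x, ∃ a : A, ∀ᶠ y in 𝓝 x, s y = fval 𝕜 E (y : M) a}
  add_mem' {s t} hs ht x := by
    obtain ⟨a, ha⟩ := hs x
    obtain ⟨b, hb⟩ := ht x
    refine ⟨a + b, ?_⟩
    filter_upwards [ha, hb] with y h1 h2
    rw [Pi.add_apply, h1, h2, map_add]
  zero_mem' x := ⟨0, by simp⟩
  smul_mem' c s hs x := by
    obtain ⟨a, ha⟩ := hs x
    refine ⟨c • a, ?_⟩
    filter_upwards [ha] with y h1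
    rw [Pi.smul_apply, h1, fval_smul]

end sections

section local_theory

variable {𝕜 E M : Type*} [RCLike 𝕜] [NormedAddCommGroup E] [NormedSpace ℝ E]
    [FiniteDimensional ℝ E]
    [TopologicalSpace M] [ChartedSpace E M] [IsManifold 𝓘(ℝ, E) ∞ M] [T2Space M]

/-- `A_V`, the sections over `V` of the vector bundle defined by `A`. -/
def LocalSec (𝕜 E A : Type*) {M : Type*} [RCLike 𝕜] [NormedAddCommGroup E] [NormedSpace ℝ E]
    [FiniteDimensional ℝ E]
    [TopologicalSpace M] [ChartedSpace E M] [IsManifold 𝓘(ℝ, E) ∞ M] [T2Space M]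
    [AddCommGroup A] [Module (SmoothFun 𝕜 E M) A] [Module 𝕜 A]
    [IsScalarTower 𝕜 (SmoothFun 𝕜 E M) A] (V : Opens M) : Type _ := ↥(localSec 𝕜 E A V)

namespace LocalSec

section module

variable {A : Type*} [AddCommGroup A] [Module (SmoothFun 𝕜 E M) A] [Module 𝕜 A]
    [IsScalarTower 𝕜 (SmoothFun 𝕜 E M) A] {V : Opens M}

instance : AddCommGroup (LocalSec 𝕜 E A V) := inferInstanceAs (AddCommGroup ↥(localSec 𝕜 E A V))
instance : Module 𝕜 (LocalSec 𝕜 E A V) := inferInstanceAs (Module 𝕜 ↥(localSec 𝕜 E A V))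
instance : DFunLike (LocalSec 𝕜 E A V) V (fun x => Fiber 𝕜 E A (x : M)) where
  coe s := s.1
  coe_injective _ _ h := Subtype.ext h

@[ext] lemma ext {s t : LocalSec 𝕜 E A V} (h : ∀ x, s x = t x) : s = t := DFunLike.ext s t h
@[simp] lemma add_apply (s t : LocalSec 𝕜 E A V) (x : V) : (s + t) x = s x + t x := rfl
@[simp] lemma sub_apply (s t : LocalSec 𝕜 E A V) (x : V) : (s - t) x = s x - t x := rfl
@[simp] lemma neg_apply (s : LocalSec 𝕜 E A V) (x : V) : (-s) x = -s x := rfl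
@[simp] lemma zero_apply (x : V) : (0 : LocalSec 𝕜 E A V) x = 0 := rfl
@[simp] lemma smul_apply (c : 𝕜) (s : LocalSec 𝕜 E A V) (x : V) : (c • s) x = c • s x := rfl

/-- `s` agrees with the global element `a` near `x`. -/
def Near (s : LocalSec 𝕜 E A V) (a : A) (x : V) : Prop := ∀ᶠ y in 𝓝 x, s y = fval 𝕜 E (y : M) a

lemma exists_near (s : LocalSec 𝕜 E A V) (x : V) : ∃ a : A, s.Near a x := s.2 x

/-- Bundle a section over `V`. -/
def mk (s : (x : V) → Fiber 𝕜 E A (x : M))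
    (hs : ∀ x, ∃ a : A, ∀ᶠ y in 𝓝 x, s y = fval 𝕜 E (y : M) a) : LocalSec 𝕜 E A V := ⟨s, hs⟩

@[simp] lemma mk_apply (s : (x : V) → Fiber 𝕜 E A (x : M)) (hs) (x : V) :
    (mk s hs : LocalSec 𝕜 E A V) x = s x := rfl

lemma Near.eq {s : LocalSec 𝕜 E A V} {a : A} {x : V} (h : s.Near a x) :
    s x = fval 𝕜 E (x : M) a := h.self_of_nhds

lemma Near.eventually {s : LocalSec 𝕜 E A V} {a : A} {x : V} (h : s.Near a x) :
    ∀ᶠ y in 𝓝 x, s.Near a y := eventually_eventually_nhds.2 h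

lemma Near.add {s t : LocalSec 𝕜 E A V} {a b : A} {x : V} (h : s.Near a x) (h' : t.Near b x) :
    (s + t).Near (a + b) x := by
  filter_upwards [h, h'] with y h1 h2
  rw [add_apply, h1, h2, map_add]

lemma Near.smul {s : LocalSec 𝕜 E A V} {a : A} {x : V} (c : 𝕜) (h : s.Near a x) :
    (c • s).Near (c • a) x := by
  filter_upwards [h] with y h1
  rw [smul_apply, h1, fval_smul]

instance : SMul (SmoothFun 𝕜 E V) (LocalSec 𝕜 E A V) where
  smul f s := mk (fun x => f x • s x) fun x => by
    obtain ⟨F, hF⟩ := exists_ext V f x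
    obtain ⟨a, ha⟩ := s.exists_near x
    refine ⟨F • a, ?_⟩
    filter_upwards [hF, ha] with y h1 h2
    rw [h1, h2, fval_fsmul]

@[simp] lemma fsmul_apply (f : SmoothFun 𝕜 E V) (s : LocalSec 𝕜 E A V) (x : V) :
    (f • s) x = f x • s x := rfl

lemma Near.fsmul {s : LocalSec 𝕜 E A V} {a : A} {x : V} {f : SmoothFun 𝕜 E V}
    {F : SmoothFun 𝕜 E M} (hf : ∀ᶠ y in 𝓝 x, f y = F y) (h : s.Near a x) :
    (f • s).Near (F • a) x := by
  filter_upwards [hf, h] with y h1 h2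
  rw [fsmul_apply, h1, h2, fval_fsmul]

instance : Module (SmoothFun 𝕜 E V) (LocalSec 𝕜 E A V) where
  one_smul s := by ext x; simp
  mul_smul f g s := by ext x; simp [mul_smul]
  smul_zero f := by ext x; simp
  smul_add f s t := by ext x; simp
  add_smul f g s := by ext x; simp [add_smul]
  zero_smul s := by ext x; simp

instance : IsScalarTower 𝕜 (SmoothFun 𝕜 E V) (LocalSec 𝕜 E A V) where
  smul_assoc c f s := by ext x; simp [mul_smul]

variable (V) in
/-- The restriction to `V` of a global section. -/
def ofGlobal (a : A) : LocalSec 𝕜 E A V := mk (fun x => fval 𝕜 E (x : M) a) fun _ =>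
  ⟨a, Eventually.of_forall fun _ => rfl⟩

/-- The restriction of sections from `U` to a smaller open set `V`. -/
def res {U : Opens M} (h : V ≤ U) (s : LocalSec 𝕜 E A U) : LocalSec 𝕜 E A V :=
  mk (fun x => s ⟨x, h x.2⟩) fun x => by
    obtain ⟨a, ha⟩ := s.exists_near ⟨x, h x.2⟩
    exact ⟨a, ((continuous_inclusion h).tendsto x).eventually ha⟩

variable [Module.Projective (SmoothFun 𝕜 E M) A]

/-- An element all of whose values vanish is zero. -/
lemma eq_zero_of_fval {a : A} (h : ∀ x : M, fval 𝕜 E x a = 0) : a = 0 := by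
  obtain ⟨σ, hσ⟩ := Module.projective_def'.1 ‹Module.Projective (SmoothFun 𝕜 E M) A›
  have hz : σ a = 0 := by
    ext i x
    have hx : a ∈ (evalIdeal 𝕜 E x • (⊤ : Submodule (SmoothFun 𝕜 E M) A)) :=
      (Submodule.Quotient.mk_eq_zero _).1 (h x)
    refine Submodule.smul_induction_on (p := fun b => (σ b i) x = 0) hx ?_ ?_
    · intro r hr n _
      have : r x = 0 := hr
      simp [this]
    · intro b c hb hc
      simp [hb, hc]
  have := congrArg (fun l => l a) hσ
  simpa [hz] using this.symm

lemma exists_bump_smul {a : A} {x : M} (h : ∀ᶠ y in 𝓝 x, fval 𝕜 E y a = 0) :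
    ∃ φ : SmoothFun 𝕜 E M, (∀ᶠ y in 𝓝 x, φ y = 1) ∧ φ • a = 0 := by
  obtain ⟨φ, h1, h2⟩ := exists_bump (𝕜 := 𝕜) (E := E) x h
  refine ⟨φ, h1, eq_zero_of_fval (𝕜 := 𝕜) (E := E) (M := M) fun y => ?_⟩
  rw [fval_fsmul]
  by_cases hy : fval 𝕜 E y a = 0
  · rw [hy, smul_zero]
  · have : φ y = 0 := image_eq_zero_of_notMem_tsupport (f := ⇑φ) fun hh => hy (h2 hh)
    rw [this, zero_smul]

lemma Near.sub_zero {s : LocalSec 𝕜 E A V} {a b : A} {x : V} (h : s.Near a x) (h' : s.Near b x) :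
    ∀ᶠ y in 𝓝 (x : M), fval 𝕜 E y (a - b) = 0 := by
  rw [← V.isOpen.isOpenEmbedding_subtypeVal.map_nhds_eq, eventually_map]
  filter_upwards [h, h'] with y h1 h2
  rw [map_sub, ← h1, ← h2, sub_self]

end module

section lie

variable {A : Type*} [LieRing A] [LieAlgebra 𝕜 A] [Module (SmoothFun 𝕜 E M) A]
  [LieRingModule A (SmoothFun 𝕜 E M)] [LieRinehartRing (SmoothFun 𝕜 E M) A]
  [LieRinehartAlgebra 𝕜 (SmoothFun 𝕜 E M) A] [Module.Projective (SmoothFun 𝕜 E M) A]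
  {V : Opens M}

lemma fval_lie_eq_zero {a : A} {x : M} (h : ∀ᶠ y in 𝓝 x, fval 𝕜 E y a = 0) (b : A) :
    fval 𝕜 E x ⁅b, a⁆ = 0 := by
  obtain ⟨φ, h1, h2⟩ := exists_bump_smul h
  have h3 : fval 𝕜 E x ⁅b, φ • a⁆ = 0 := by rw [h2, lie_zero, map_zero]
  rwa [LieRinehartRing.leibniz_smul_right, map_add, fval_fsmul, fval_fsmul, h1.self_of_nhds,
    h.self_of_nhds, one_smul, smul_zero, add_zero] at h3

lemma lie_fun_eq_zero {a : A} {x : M} (h : ∀ᶠ y in 𝓝 x, fval 𝕜 E y a = 0)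
    (f : SmoothFun 𝕜 E M) : ⁅a, f⁆ x = 0 := by
  obtain ⟨φ, h1, h2⟩ := exists_bump_smul h
  have h3 : ⁅φ • a, f⁆ x = 0 := by rw [h2, zero_lie]; rfl
  rwa [LieRinehartRing.lie_smul_eq_mul, SmoothFun.mul_apply, h1.self_of_nhds, one_mul] at h3

lemma fval_lie_congr {s t : LocalSec 𝕜 E A V} {a a' b b' : A} {x : V} (ha : s.Near a x)
    (ha' : s.Near a' x) (hb : t.Near b x) (hb' : t.Near b' x) :
    fval 𝕜 E (x : M) ⁅a, b⁆ = fval 𝕜 E (x : M) ⁅a', b'⁆ := by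
  have h1 := fval_lie_eq_zero (ha.sub_zero ha') b
  have h2 := fval_lie_eq_zero (hb.sub_zero hb') a'
  rw [← lie_skew, map_neg, neg_eq_zero, sub_lie, map_sub, sub_eq_zero] at h1
  rw [lie_sub, map_sub, sub_eq_zero] at h2
  rw [h1, h2]

lemma lie_fun_congr {s : LocalSec 𝕜 E A V} {a a' : A} {x : V} (ha : s.Near a x)
    (ha' : s.Near a' x) {f f' : SmoothFun 𝕜 E M}
    (hf : ∀ᶠ y : V in 𝓝 x, f y = f' y) : ⁅a, f⁆ x = ⁅a', f'⁆ x := by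
  have h1 := lie_fun_eq_zero (ha.sub_zero ha') f
  rw [sub_lie, SmoothFun.sub_apply, sub_eq_zero] at h1
  rw [h1]
  refine der_local (LieRinehartAlgebra.anchor 𝕜 (SmoothFun 𝕜 E M) A a') (x : M) ?_
  rw [← V.isOpen.isOpenEmbedding_subtypeVal.map_nhds_eq, eventually_map]
  exact hf

/-- The bracket on `A_V`: near each point, `[s, t]` is the bracket of any two elements of `A` that
agree with `s` and `t` there. -/
instance : Bracket (LocalSec 𝕜 E A V) (LocalSec 𝕜 E A V) where
  bracket s t := mk (fun x => fval 𝕜 E (x : M) ⁅(s.exists_near x).choose, (t.exists_near x).choose⁆)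
    fun x => ⟨⁅(s.exists_near x).choose, (t.exists_near x).choose⁆, by
      filter_upwards [(s.exists_near x).choose_spec.eventually,
        (t.exists_near x).choose_spec.eventually] with y h1 h2
      exact fval_lie_congr (s.exists_near y).choose_spec h1 (t.exists_near y).choose_spec h2⟩

lemma Near.lie_apply {s t : LocalSec 𝕜 E A V} {a b : A} {x : V} (ha : s.Near a x)
    (hb : t.Near b x) : ⁅s, t⁆ x = fval 𝕜 E (x : M) ⁅a, b⁆ :=
  fval_lie_congr (s.exists_near x).choose_spec ha (t.exists_near x).choose_spec hb

lemma Near.lie {s t : LocalSec 𝕜 E A V} {a b : A} {x : V} (ha : s.Near a x)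
    (hb : t.Near b x) : (⁅s, t⁆ : LocalSec 𝕜 E A V).Near ⁅a, b⁆ x := by
  filter_upwards [ha.eventually, hb.eventually] with y h1 h2 using h1.lie_apply h2

instance : LieRing (LocalSec 𝕜 E A V) where
  add_lie s t u := by
    ext x
    obtain ⟨a, ha⟩ := s.exists_near x
    obtain ⟨b, hb⟩ := t.exists_near x
    obtain ⟨c, hc⟩ := u.exists_near x
    rw [(ha.add hb).lie_apply hc, add_apply, ha.lie_apply hc, hb.lie_apply hc, add_lie, map_add]
  lie_add s t u := by
    ext x
    obtain ⟨a, ha⟩ := s.exists_near x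
    obtain ⟨b, hb⟩ := t.exists_near x
    obtain ⟨c, hc⟩ := u.exists_near x
    rw [ha.lie_apply (hb.add hc), add_apply, ha.lie_apply hc, ha.lie_apply hb, lie_add, map_add]
  lie_self s := by
    ext x
    obtain ⟨a, ha⟩ := s.exists_near x
    rw [ha.lie_apply ha, lie_self, map_zero, zero_apply]
  leibniz_lie s t u := by
    ext x
    obtain ⟨a, ha⟩ := s.exists_near x
    obtain ⟨b, hb⟩ := t.exists_near x
    obtain ⟨c, hc⟩ := u.exists_near x
    rw [ha.lie_apply (hb.lie hc), add_apply, (ha.lie hb).lie_apply hc, hb.lie_apply (ha.lie hc),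
      leibniz_lie, map_add]

instance : LieAlgebra 𝕜 (LocalSec 𝕜 E A V) where
  lie_smul k s t := by
    ext x
    obtain ⟨a, ha⟩ := s.exists_near x
    obtain ⟨b, hb⟩ := t.exists_near x
    rw [ha.lie_apply (hb.smul k), smul_apply, ha.lie_apply hb, lie_smul, fval_smul]

/-- The action of `A_V` on `C^∞(V)`, i.e. the anchor of `A_V`. -/
instance : Bracket (LocalSec 𝕜 E A V) (SmoothFun 𝕜 E V) where
  bracket s f := SmoothFun.mk
    (fun x => (⁅(s.exists_near x).choose, (exists_ext V f x).choose⁆ : SmoothFun 𝕜 E M) x)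
    (smoothFun_of_local fun x => ⟨SmoothFun.restrict V
      ⁅(s.exists_near x).choose, (exists_ext V f x).choose⁆, by
      filter_upwards [(s.exists_near x).choose_spec.eventually,
        eventually_eventually_nhds.2 (exists_ext V f x).choose_spec] with y h1 h2
      refine lie_fun_congr (s.exists_near y).choose_spec h1 ?_
      filter_upwards [h2, (exists_ext V f y).choose_spec] with z h3 h4
      rw [← h3, ← h4]⟩)

lemma Near.act_apply {s : LocalSec 𝕜 E A V} {f : SmoothFun 𝕜 E V} {a : A} {F : SmoothFun 𝕜 E M}
    {x : V} (ha : s.Near a x) (hf : ∀ᶠ y in 𝓝 x, f y = F y) :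
    (⁅s, f⁆ : SmoothFun 𝕜 E V) x = ⁅a, F⁆ x := by
  refine lie_fun_congr (s.exists_near x).choose_spec ha ?_
  filter_upwards [hf, (exists_ext V f x).choose_spec] with z h3 h4
  rw [← h3, ← h4]

lemma Near.act {s : LocalSec 𝕜 E A V} {f : SmoothFun 𝕜 E V} {a : A} {F : SmoothFun 𝕜 E M}
    {x : V} (ha : s.Near a x) (hf : ∀ᶠ y in 𝓝 x, f y = F y) :
    ∀ᶠ y in 𝓝 x, (⁅s, f⁆ : SmoothFun 𝕜 E V) y = (⁅a, F⁆ : SmoothFun 𝕜 E M) y := by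
  filter_upwards [ha.eventually, eventually_eventually_nhds.2 hf] with y h1 h2
    using h1.act_apply h2

instance : LieRingModule (LocalSec 𝕜 E A V) (SmoothFun 𝕜 E V) where
  add_lie s t f := by
    ext x
    obtain ⟨a, ha⟩ := s.exists_near x
    obtain ⟨b, hb⟩ := t.exists_near x
    obtain ⟨F, hF⟩ := exists_ext V f x
    rw [(ha.add hb).act_apply hF, SmoothFun.add_apply, ha.act_apply hF, hb.act_apply hF, add_lie,
      SmoothFun.add_apply]
  lie_add s f g := by
    ext x
    obtain ⟨a, ha⟩ := s.exists_near x
    obtain ⟨F, hF⟩ := exists_ext V f x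
    obtain ⟨G, hG⟩ := exists_ext V g x
    rw [ha.act_apply (F := F + G), SmoothFun.add_apply, ha.act_apply hF, ha.act_apply hG, lie_add,
      SmoothFun.add_apply]
    filter_upwards [hF, hG] with y h1 h2
    simp [h1, h2]
  leibniz_lie s t f := by
    ext x
    obtain ⟨a, ha⟩ := s.exists_near x
    obtain ⟨b, hb⟩ := t.exists_near x
    obtain ⟨F, hF⟩ := exists_ext V f x
    rw [ha.act_apply (hb.act hF), SmoothFun.add_apply, (ha.lie hb).act_apply hF,
      hb.act_apply (ha.act hF), leibniz_lie, SmoothFun.add_apply]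

instance : LieRinehartRing (SmoothFun 𝕜 E V) (LocalSec 𝕜 E A V) where
  lie_smul_eq_mul' f g s := by
    ext x
    obtain ⟨a, ha⟩ := s.exists_near x
    obtain ⟨F, hF⟩ := exists_ext V f x
    obtain ⟨G, hG⟩ := exists_ext V g x
    rw [(ha.fsmul hF).act_apply hG, SmoothFun.mul_apply, ha.act_apply hG,
      LieRinehartRing.lie_smul_eq_mul, SmoothFun.mul_apply, hF.self_of_nhds]
  leibniz_mul_right' s f g := by
    ext x
    obtain ⟨a, ha⟩ := s.exists_near x
    obtain ⟨F, hF⟩ := exists_ext V f x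
    obtain ⟨G, hG⟩ := exists_ext V g x
    have hFG : ∀ᶠ y in 𝓝 x, (f * g) y = (F * G : SmoothFun 𝕜 E M) y := by
      filter_upwards [hF, hG] with y h1 h2
      simp [h1, h2]
    rw [ha.act_apply hFG, LieRinehartRing.leibniz_mul_right]
    simp only [smul_eq_mul, SmoothFun.add_apply, SmoothFun.mul_apply]
    rw [ha.act_apply hG, ha.act_apply hF, hF.self_of_nhds, hG.self_of_nhds]
  leibniz_smul_right' s t f := by
    ext x
    obtain ⟨a, ha⟩ := s.exists_near x
    obtain ⟨b, hb⟩ := t.exists_near x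
    obtain ⟨F, hF⟩ := exists_ext V f x
    rw [ha.lie_apply (hb.fsmul hF), add_apply, fsmul_apply, fsmul_apply, ha.lie_apply hb,
      ha.act_apply hF, hb.eq, LieRinehartRing.leibniz_smul_right, map_add, fval_fsmul, fval_fsmul,
      hF.self_of_nhds]

instance : LieRinehartAlgebra 𝕜 (SmoothFun 𝕜 E V) (LocalSec 𝕜 E A V) where
  smul_lie c s f := by
    ext x
    obtain ⟨a, ha⟩ := s.exists_near x
    obtain ⟨F, hF⟩ := exists_ext V f x
    rw [(ha.smul c).act_apply hF, SmoothFun.smul_apply, ha.act_apply hF, smul_lie,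
      SmoothFun.smul_apply]
  lie_smul c s f := by
    ext x
    obtain ⟨a, ha⟩ := s.exists_near x
    obtain ⟨F, hF⟩ := exists_ext V f x
    rw [ha.act_apply (F := c • F), SmoothFun.smul_apply, ha.act_apply hF, lie_smul,
      SmoothFun.smul_apply]
    filter_upwards [hF] with y h1
    simp [h1]

end lie

end LocalSec

namespace LocalSec

variable {A : Type*} [LieRing A] [LieAlgebra 𝕜 A] [Module (SmoothFun 𝕜 E M) A]
  [LieRingModule A (SmoothFun 𝕜 E M)] [LieRinehartRing (SmoothFun 𝕜 E M) A]
  [LieRinehartAlgebra 𝕜 (SmoothFun 𝕜 E M) A] [Module.Projective (SmoothFun 𝕜 E M) A]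

lemma fval_form_update {q : ℕ}
    (θ : KForm 𝕜 (SmoothFun 𝕜 E M) A q) (x : M)
    (X : Fin q → A) (k : Fin q) {a b : A} (h : fval 𝕜 E x a = fval 𝕜 E x b) :
    fval 𝕜 E x (θ (Function.update X k a) : A) = fval 𝕜 E x (θ (Function.update X k b) : A) := by
  have hx : a - b ∈ (evalIdeal 𝕜 E x • (⊤ : Submodule (SmoothFun 𝕜 E M) A)) :=
    (Submodule.Quotient.mk_eq_zero _).1 (by
      change fval 𝕜 E x (a - b) = 0
      rw [map_sub, h, sub_self])
  have key : ∀ c ∈ (evalIdeal 𝕜 E x • (⊤ : Submodule (SmoothFun 𝕜 E M) A)),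
      fval 𝕜 E x (θ (Function.update X k c) : A) = 0 := by
    intro c hc
    refine Submodule.smul_induction_on hc ?_ ?_
    · intro r hr n _
      rw [θ.map_update_smul, Submodule.coe_smul]
      exact fval_eq_zero_of_mem hr _
    · intro u v hu hv
      rw [θ.map_update_add, Submodule.coe_add, map_add, hu, hv, add_zero]
  have := key _ hx
  rwa [θ.map_update_sub, Submodule.coe_sub, map_sub, sub_eq_zero] at this

lemma fval_form_congr {q : ℕ}
    (θ : KForm 𝕜 (SmoothFun 𝕜 E M) A q) (x : M)
    (X Y : Fin q → A) (h : ∀ k, fval 𝕜 E x (X k) = fval 𝕜 E x (Y k)) :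
    fval 𝕜 E x (θ X : A) = fval 𝕜 E x (θ Y : A) := by
  classical
  have key : ∀ s : Finset (Fin q),
      fval 𝕜 E x (θ (s.piecewise Y X) : A) = fval 𝕜 E x (θ X : A) := by
    intro s
    induction s using Finset.induction_on with
    | empty => simp
    | insert j s hj ih =>
      rw [Finset.piecewise_insert, ← ih]
      conv_rhs => rw [← Function.update_eq_self j (s.piecewise Y X)]
      refine fval_form_update θ x _ j ?_
      rw [Finset.piecewise_eq_of_notMem _ _ _ hj, h]
  rw [← key Finset.univ, Finset.piecewise_univ]

variable {V : Opens M}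

/-- The section `θ(s₁, …, s_q)`. -/
def formVal {q : ℕ} (θ : KForm 𝕜 (SmoothFun 𝕜 E M) A q)
    (s : Fin q → LocalSec 𝕜 E A V) : LocalSec 𝕜 E A V :=
  mk (fun x => fval 𝕜 E (x : M) (θ fun k => ((s k).exists_near x).choose : A)) fun x =>
    ⟨(θ fun k => ((s k).exists_near x).choose : A), by
      filter_upwards [eventually_all.2 fun k => ((s k).exists_near x).choose_spec] with y hy
      refine fval_form_congr θ _ _ _ fun k => ?_
      rw [← hy k, ← ((s k).exists_near y).choose_spec.eq]⟩

lemma formVal_apply {q : ℕ} (θ : KForm 𝕜 (SmoothFun 𝕜 E M) A q)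
    {s : Fin q → LocalSec 𝕜 E A V} {a : Fin q → A} {x : V}
    (h : ∀ k, s k x = fval 𝕜 E (x : M) (a k)) :
    formVal θ s x = fval 𝕜 E (x : M) (θ a : A) := by
  refine fval_form_congr θ _ _ _ fun k => ?_
  rw [← h k, ← ((s k).exists_near x).choose_spec.eq]

lemma formVal_near {q : ℕ} (θ : KForm 𝕜 (SmoothFun 𝕜 E M) A q)
    {s : Fin q → LocalSec 𝕜 E A V} {a : Fin q → A} {x : V} (h : ∀ k, (s k).Near (a k) x) :
    (formVal θ s).Near (θ a : A) x := by
  filter_upwards [eventually_all.2 h] with y hy using formVal_apply θ hy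

lemma formVal_mem {q : ℕ} (θ : KForm 𝕜 (SmoothFun 𝕜 E M) A q)
    (s : Fin q → LocalSec 𝕜 E A V) :
    formVal θ s ∈ kernel 𝕜 (SmoothFun 𝕜 E V) (LocalSec 𝕜 E A V) := by
  rw [mem_kernel]
  intro f
  ext x
  obtain ⟨F, hF⟩ := exists_ext V f x
  rw [(formVal_near θ fun k => ((s k).exists_near x).choose_spec).act_apply hF,
    mem_kernel.1 (θ _).2]
  rfl

variable (V) in
/-- The restriction to `V` of a form in `Ω^q(A, L)`, a form on `A_V` with values in its kernel:
its value at `x` on `s₁, …, s_q` is the value at `x` of `θ(a₁, …, a_q)` for any `aₖ ∈ A` that have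
the same values at `x` as the `sₖ`. -/
def restrictForm {q : ℕ} (θ : KForm 𝕜 (SmoothFun 𝕜 E M) A q) :
    KForm 𝕜 (SmoothFun 𝕜 E V) (LocalSec 𝕜 E A V) q where
  toFun s := ⟨formVal θ s, formVal_mem θ s⟩
  map_update_add' {hd} s i t u := by
    cases Subsingleton.elim hd (instDecidableEqFin q)
    refine Subtype.ext (LocalSec.ext fun x => ?_)
    choose a ha using fun k => (s k).exists_near x
    obtain ⟨b, hb⟩ := t.exists_near x
    obtain ⟨c, hc⟩ := u.exists_near x
    have h : ∀ (t : LocalSec 𝕜 E A V) (b : A), t x = fval 𝕜 E (x : M) b → ∀ k,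
        Function.update s i t k x = fval 𝕜 E (x : M) (Function.update a i b k) := by
      intro t b hb k
      by_cases hk : k = i
      · subst hk; simpa using hb
      · simpa [hk] using (ha k).eq
    rw [Submodule.coe_add, add_apply, formVal_apply θ (h _ _ hb.eq), formVal_apply θ (h _ _ hc.eq),
      formVal_apply θ (h _ _ (hb.add hc).eq), θ.map_update_add, Submodule.coe_add, map_add]
  map_update_smul' {hd} s i f t := by
    cases Subsingleton.elim hd (instDecidableEqFin q)
    refine Subtype.ext (LocalSec.ext fun x => ?_)
    choose a ha using fun k => (s k).exists_near x
    obtain ⟨b, hb⟩ := t.exists_near x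
    obtain ⟨F, hF⟩ := exists_ext V f x
    have h : ∀ (t : LocalSec 𝕜 E A V) (b : A), t x = fval 𝕜 E (x : M) b → ∀ k,
        Function.update s i t k x = fval 𝕜 E (x : M) (Function.update a i b k) := by
      intro t b hb k
      by_cases hk : k = i
      · subst hk; simpa using hb
      · simpa [hk] using (ha k).eq
    rw [Submodule.coe_smul, fsmul_apply, formVal_apply θ (h _ _ hb.eq),
      formVal_apply θ (h _ _ (hb.fsmul hF).eq), θ.map_update_smul, Submodule.coe_smul, fval_fsmul,
      hF.self_of_nhds]
  map_eq_zero_of_eq' s i j h hij := by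
    refine Subtype.ext (LocalSec.ext fun x => ?_)
    choose a ha using fun k => (s k).exists_near x
    have h' : ∀ k, s k x = fval 𝕜 E (x : M) (Function.update a j (a i) k) := by
      intro k
      by_cases hk : k = j
      · subst hk; rw [← h]; simpa using (ha i).eq
      · simpa [hk] using (ha k).eq
    rw [formVal_apply θ h', θ.map_eq_zero_of_eq _ (by simp [hij]) hij, Submodule.coe_zero, map_zero]
    rfl

end LocalSec

/-! ### Local trivializations -/

section triv

variable {g A : Type*} [LieRing g] [LieAlgebra 𝕜 g]
  [LieRing A] [LieAlgebra 𝕜 A] [Module (SmoothFun 𝕜 E M) A]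
  [LieRingModule A (SmoothFun 𝕜 E M)] [LieRinehartRing (SmoothFun 𝕜 E M) A]
  [LieRinehartAlgebra 𝕜 (SmoothFun 𝕜 E M) A] [Module.Projective (SmoothFun 𝕜 E M) A]

variable (𝕜 E g A) in
/-- A local trivialization `(U, Ψ, ∇⁰)` of `A` over `U`: an isomorphism `Ψ : Γ(U × g) ≃ L_U` of Lie
algebras and `C^∞(U)`-modules onto the kernel of `A_U`, and a `C^∞(U)`-linear morphism of Lie
algebras `∇⁰ = conn : Γ(TU) → A_U` which is a section of the anchor, such that
`[∇⁰_X, Ψ(γ)] = Ψ(X · γ)`. -/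
structure LocalTriv (U : Opens M) where
  Ψ : (SmoothFun 𝕜 E U ⊗[𝕜] g) ≃ₗ[SmoothFun 𝕜 E U]
    kernel 𝕜 (SmoothFun 𝕜 E U) (LocalSec 𝕜 E A U)
  conn : Derivation 𝕜 (SmoothFun 𝕜 E U) (SmoothFun 𝕜 E U) →ₗ[SmoothFun 𝕜 E U] LocalSec 𝕜 E A U
  Ψ_lie : ∀ γ η, ⁅(Ψ γ : LocalSec 𝕜 E A U), (Ψ η : LocalSec 𝕜 E A U)⁆ = Ψ ⁅γ, η⁆
  conn_lie : ∀ X Y, ⁅conn X, conn Y⁆ = conn ⁅X, Y⁆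
  anchor_conn : ∀ X, LieRinehartAlgebra.anchor 𝕜 (SmoothFun 𝕜 E U) (LocalSec 𝕜 E A U) (conn X) = X
  conn_Ψ : ∀ X γ, ⁅conn X, (Ψ γ : LocalSec 𝕜 E A U)⁆ = Ψ (derAct g X γ)

namespace LocalTriv

variable {U : Opens M} (T T' : LocalTriv 𝕜 E g A U)

lemma sub_conn_mem (a : LocalSec 𝕜 E A U) :
    a - T.conn (LieRinehartAlgebra.anchor 𝕜 (SmoothFun 𝕜 E U) (LocalSec 𝕜 E A U) a) ∈
      kernel 𝕜 (SmoothFun 𝕜 E U) (LocalSec 𝕜 E A U) := by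
  change LieRinehartAlgebra.anchor 𝕜 (SmoothFun 𝕜 E U) (LocalSec 𝕜 E A U) _ = 0
  rw [map_sub, T.anchor_conn, sub_self]

/-- The isomorphism `S : TLA(U, g) ≃ A_U`, `S(X ⊕ γ) = ∇⁰_X + Ψ(γ)`. -/
def S : TLA 𝕜 (SmoothFun 𝕜 E U) g ≃ₗ[SmoothFun 𝕜 E U] LocalSec 𝕜 E A U where
  toFun Y := T.conn Y.1 + (T.Ψ Y.2 : LocalSec 𝕜 E A U)
  map_add' Y Z := by simp only [Prod.fst_add, Prod.snd_add, map_add, Submodule.coe_add]; abel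
  map_smul' f Y := by
    simp only [Prod.smul_fst, Prod.smul_snd, map_smul, Submodule.coe_smul, smul_add,
      RingHom.id_apply]
  invFun a := (LieRinehartAlgebra.anchor 𝕜 (SmoothFun 𝕜 E U) (LocalSec 𝕜 E A U) a,
    T.Ψ.symm ⟨_, T.sub_conn_mem a⟩)
  left_inv Y := by
    have h1 : LieRinehartAlgebra.anchor 𝕜 (SmoothFun 𝕜 E U) (LocalSec 𝕜 E A U)
        (T.conn Y.1 + (T.Ψ Y.2 : LocalSec 𝕜 E A U)) = Y.1 := by
      have h2 : LieRinehartAlgebra.anchor 𝕜 (SmoothFun 𝕜 E U) (LocalSec 𝕜 E A U) (T.Ψ Y.2) = 0 :=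
        (T.Ψ Y.2).2
      rw [map_add, T.anchor_conn, h2, add_zero]
    refine Prod.ext h1 ?_
    rw [LinearEquiv.symm_apply_eq]
    refine Subtype.ext ?_
    change _ - T.conn _ = _
    rw [h1, add_sub_cancel_left]
  right_inv a := by
    simp

/-- The local expression `θ_loc = Ψ⁻¹ ∘ θ ∘ S` of a form `θ ∈ Ω^q(A, L)`. -/
def localForm {q : ℕ} (θ : KForm 𝕜 (SmoothFun 𝕜 E M) A q) :
    TLAForm 𝕜 (SmoothFun 𝕜 E U) g q :=
  (T.Ψ.symm : _ →ₗ[SmoothFun 𝕜 E U] _).compAlternatingMap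
    ((LocalSec.restrictForm U θ).compLinearMap (T.S : _ →ₗ[SmoothFun 𝕜 E U] _))

/-- `α = Ψ⁻¹ ∘ Ψ'` for two local trivializations over the same open set. -/
def alpha : (SmoothFun 𝕜 E U ⊗[𝕜] g) ≃ₗ[SmoothFun 𝕜 E U] (SmoothFun 𝕜 E U ⊗[𝕜] g) :=
  T'.Ψ.trans T.Ψ.symm

/-- `s = S'⁻¹ ∘ S` for two local trivializations over the same open set. -/
def transition : TLA 𝕜 (SmoothFun 𝕜 E U) g ≃ₗ[SmoothFun 𝕜 E U] TLA 𝕜 (SmoothFun 𝕜 E U) g :=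
  T.S.trans T'.S.symm

/-- The change of trivialization `θ ↦ α ∘ θ ∘ s`, from `T'` to `T`. -/
def alphaHat (q : ℕ) :
    TLAForm 𝕜 (SmoothFun 𝕜 E U) g q →ₗ[SmoothFun 𝕜 E U] TLAForm 𝕜 (SmoothFun 𝕜 E U) g q where
  toFun θ := (alpha T T' : _ →ₗ[SmoothFun 𝕜 E U] _).compAlternatingMap
    (θ.compLinearMap (transition T T' : _ →ₗ[SmoothFun 𝕜 E U] _))
  map_add' θ η := by ext; simp
  map_smul' f θ := by ext; simp

end LocalTriv
end triv

namespace LocalSec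

variable {A : Type*} [LieRing A] [LieAlgebra 𝕜 A] [Module (SmoothFun 𝕜 E M) A]
  [LieRingModule A (SmoothFun 𝕜 E M)] [LieRinehartRing (SmoothFun 𝕜 E M) A]
  [LieRinehartAlgebra 𝕜 (SmoothFun 𝕜 E M) A] [Module.Projective (SmoothFun 𝕜 E M) A]
  {U V : Opens M}

@[simp] lemma res_apply (h : V ≤ U) (s : LocalSec 𝕜 E A U) (x : V) :
    res h s x = s ⟨x, h x.2⟩ := rfl

lemma sum_apply {ι : Type*} (t : Finset ι) (s : ι → LocalSec 𝕜 E A V) (x : V) :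
    (∑ i ∈ t, s i) x = ∑ i ∈ t, s i x := by
  classical
  induction t using Finset.induction_on with
  | empty => rfl
  | insert i t hi ih => rw [Finset.sum_insert hi, Finset.sum_insert hi, add_apply, ih]

lemma Near.res {h : V ≤ U} {s : LocalSec 𝕜 E A U} {a : A} {x : V} (hs : s.Near a ⟨x, h x.2⟩) :
    (LocalSec.res h s).Near a x :=
  ((continuous_inclusion h).tendsto x).eventually hs

lemma Near.act_restrict {s : LocalSec 𝕜 E A V} {a : A} {x : V} (ha : s.Near a x)
    (F : SmoothFun 𝕜 E M) : (⁅s, SmoothFun.restrict V F⁆ : SmoothFun 𝕜 E V) x = ⁅a, F⁆ x :=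
  ha.act_apply (Eventually.of_forall fun _ => rfl)

lemma res_lie (h : V ≤ U) (s t : LocalSec 𝕜 E A U) : res h ⁅s, t⁆ = ⁅res h s, res h t⁆ := by
  ext x
  obtain ⟨a, ha⟩ := s.exists_near ⟨x, h x.2⟩
  obtain ⟨b, hb⟩ := t.exists_near ⟨x, h x.2⟩
  rw [res_apply, ha.lie_apply hb, ha.res.lie_apply hb.res]

lemma res_mem_kernel (h : V ≤ U) {s : LocalSec 𝕜 E A U}
    (hs : s ∈ kernel 𝕜 (SmoothFun 𝕜 E U) (LocalSec 𝕜 E A U)) :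
    res h s ∈ kernel 𝕜 (SmoothFun 𝕜 E V) (LocalSec 𝕜 E A V) := by
  rw [mem_kernel] at hs ⊢
  intro f
  ext x
  obtain ⟨a, ha⟩ := s.exists_near ⟨x, h x.2⟩
  obtain ⟨F, hF⟩ := exists_ext V f x
  rw [ha.res.act_apply hF]
  rw [← ha.act_restrict F, hs]
  rfl

open Classical in
/-- The product `φ s` of a section over `V` with a function supported in `V`, extended by zero
to `U`. -/
def zeroExt (_h : V ≤ U) (φ : SmoothFun 𝕜 E M) (hφ : tsupport φ ⊆ V) (s : LocalSec 𝕜 E A V) :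
    LocalSec 𝕜 E A U :=
  mk (fun y => if hy : (y : M) ∈ V then φ y • s ⟨y, hy⟩ else 0) fun y => by
    by_cases hy : (y : M) ∈ V
    · obtain ⟨a, ha⟩ := s.exists_near ⟨y, hy⟩
      refine ⟨φ • a, ?_⟩
      have h1 : ∀ᶠ z in 𝓝 (y : M), ∀ hz : z ∈ V, s ⟨z, hz⟩ = fval 𝕜 E z a := by
        rw [← V.isOpen.isOpenEmbedding_subtypeVal.map_nhds_eq ⟨y, hy⟩, eventually_map]
        filter_upwards [ha] with z hz _ using hz
      filter_upwards [continuous_subtype_val.continuousAt.eventually h1,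
        continuous_subtype_val.continuousAt.eventually (V.isOpen.mem_nhds hy)] with z hz hz'
      have hz'' : (z : M) ∈ V := hz'
      rw [dif_pos hz'', hz hz'', fval_fsmul]
    · refine ⟨0, ?_⟩
      have h1 : (y : M) ∉ tsupport φ := fun hh => hy (hφ hh)
      have h2 := (notMem_tsupport_iff_eventuallyEq (f := ⇑φ)).1 h1
      filter_upwards [continuous_subtype_val.continuousAt.eventually h2] with z hz
      rw [map_zero]
      split_ifs
      · have hz' : φ z = 0 := hz
        rw [hz', zero_smul]
      · rfl

lemma zeroExt_apply (h : V ≤ U) (φ : SmoothFun 𝕜 E M) (hφ : tsupport φ ⊆ V)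
    (s : LocalSec 𝕜 E A V) (y : V) : zeroExt h φ hφ s ⟨y, h y.2⟩ = φ y • s y := by
  simp only [zeroExt, mk_apply, y.2, dif_pos]

lemma zeroExt_apply_of_notMem (h : V ≤ U) (φ : SmoothFun 𝕜 E M) (hφ : tsupport φ ⊆ V)
    (s : LocalSec 𝕜 E A V) {y : U} (hy : (y : M) ∉ V) : zeroExt h φ hφ s y = 0 := by
  simp only [zeroExt, mk_apply, hy, dif_neg, not_false_eq_true]

lemma res_zeroExt (h : V ≤ U) (φ : SmoothFun 𝕜 E M) (hφ : tsupport φ ⊆ V)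
    (s : LocalSec 𝕜 E A V) : res h (zeroExt h φ hφ s) = SmoothFun.restrict V φ • s := by
  ext x
  exact zeroExt_apply h φ hφ s x

lemma zeroExt_mem_kernel (h : V ≤ U) (φ : SmoothFun 𝕜 E M) (hφ : tsupport φ ⊆ V)
    {s : LocalSec 𝕜 E A V} (hs : s ∈ kernel 𝕜 (SmoothFun 𝕜 E V) (LocalSec 𝕜 E A V)) :
    zeroExt h φ hφ s ∈ kernel 𝕜 (SmoothFun 𝕜 E U) (LocalSec 𝕜 E A U) := by
  rw [mem_kernel]
  intro f
  ext y
  obtain ⟨F, hF⟩ := exists_ext U f y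
  by_cases hy : (y : M) ∈ V
  · obtain ⟨a, ha⟩ := (zeroExt h φ hφ s).exists_near y
    rw [ha.act_apply hF]
    have h1 : (res h (zeroExt h φ hφ s)).Near a ⟨y, hy⟩ := Near.res (h := h) ha
    have h2 := mem_kernel.1 ((kernel 𝕜 (SmoothFun 𝕜 E V) (LocalSec 𝕜 E A V)).smul_mem
      (SmoothFun.restrict V φ) hs) (SmoothFun.restrict V F)
    rw [← res_zeroExt h φ hφ s] at h2
    have h3 := h1.act_restrict F
    rw [h2] at h3
    exact h3.symm
  · have h1 : (y : M) ∉ tsupport φ := fun hh => hy (hφ hh)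
    have h2 := (notMem_tsupport_iff_eventuallyEq (f := ⇑φ)).1 h1
    have h3 : (zeroExt h φ hφ s).Near 0 y := by
      filter_upwards [continuous_subtype_val.continuousAt.eventually h2] with z hz
      rw [map_zero]
      have hz' : φ z = 0 := hz
      by_cases hzV : (z : M) ∈ V
      · have := zeroExt_apply h φ hφ s ⟨z, hzV⟩
        rw [hz', zero_smul] at this
        exact this
      · exact zeroExt_apply_of_notMem h φ hφ s hzV
    rw [h3.act_apply hF, zero_lie]
    rfl

end LocalSec

section restrict

variable {g A : Type*} [LieRing g] [LieAlgebra 𝕜 g]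
  [LieRing A] [LieAlgebra 𝕜 A] [Module (SmoothFun 𝕜 E M) A]
  [LieRingModule A (SmoothFun 𝕜 E M)] [LieRinehartRing (SmoothFun 𝕜 E M) A]
  [LieRinehartAlgebra 𝕜 (SmoothFun 𝕜 E M) A] [Module.Projective (SmoothFun 𝕜 E M) A]
  {U V : Opens M}

namespace LocalTriv

lemma conn_congr (T : LocalTriv 𝕜 E g A U) (h : V ≤ U)
    {X : Derivation 𝕜 (SmoothFun 𝕜 E V) (SmoothFun 𝕜 E V)}
    {D D' : Derivation 𝕜 (SmoothFun 𝕜 E M) (SmoothFun 𝕜 E M)} {x : V} (hD : DerNear X D x)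
    (hD' : DerNear X D' x) :
    T.conn (restrictDer U D) ⟨x, h x.2⟩ = T.conn (restrictDer U D') ⟨x, h x.2⟩ := by
  have h1 : ∀ᶠ y in 𝓝 (x : M), ∀ F, D F y = D' F y := by
    rw [← V.isOpen.isOpenEmbedding_subtypeVal.map_nhds_eq, eventually_map]
    filter_upwards [hD, hD'] with y h1 h2 F
    rw [← h1, ← h2]
  obtain ⟨φ, h2, h3⟩ := exists_bump (𝕜 := 𝕜) (E := E) (x : M) h1
  have h4 : φ • D = φ • D' := by
    ext F y
    change φ y * D F y = φ y * D' F y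
    by_cases hy : ∀ F, D F y = D' F y
    · rw [hy]
    · have : φ y = 0 := image_eq_zero_of_notMem_tsupport (f := ⇑φ) fun hh => hy (h3 hh)
      rw [this, zero_mul, zero_mul]
  have h5 := congrArg (fun D => T.conn (restrictDer U D) ⟨x, h x.2⟩) h4
  simp only [restrictDer_smul, map_smul, LocalSec.fsmul_apply] at h5
  have h6 : SmoothFun.restrict U φ ⟨x, h x.2⟩ = 1 := h2.self_of_nhds
  rwa [h6, one_smul, one_smul] at h5

/-- The restriction of `∇⁰` to `V`: its value at `x` on `X ∈ Γ(TV)` is that of `∇⁰` on any vector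
field that agrees with `X` near `x`. -/
def connRes (T : LocalTriv 𝕜 E g A U) (h : V ≤ U)
    (X : Derivation 𝕜 (SmoothFun 𝕜 E V) (SmoothFun 𝕜 E V)) : LocalSec 𝕜 E A V :=
  LocalSec.mk (fun x => T.conn (restrictDer U (exists_derNear X x).choose) ⟨x, h x.2⟩) fun x => by
    obtain ⟨a, ha⟩ :=
      (T.conn (restrictDer U (exists_derNear X x).choose)).exists_near ⟨x, h x.2⟩
    refine ⟨a, ?_⟩
    filter_upwards [(exists_derNear X x).choose_spec.eventually, ha.res] with y h1 h2
    rw [← h2]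
    exact T.conn_congr h (exists_derNear X y).choose_spec h1

lemma connRes_apply (T : LocalTriv 𝕜 E g A U) (h : V ≤ U)
    {X : Derivation 𝕜 (SmoothFun 𝕜 E V) (SmoothFun 𝕜 E V)}
    {D : Derivation 𝕜 (SmoothFun 𝕜 E M) (SmoothFun 𝕜 E M)} {x : V} (hD : DerNear X D x) :
    T.connRes h X x = T.conn (restrictDer U D) ⟨x, h x.2⟩ :=
  T.conn_congr h (exists_derNear X x).choose_spec hD

lemma connRes_near (T : LocalTriv 𝕜 E g A U) (h : V ≤ U)
    {X : Derivation 𝕜 (SmoothFun 𝕜 E V) (SmoothFun 𝕜 E V)}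
    {D : Derivation 𝕜 (SmoothFun 𝕜 E M) (SmoothFun 𝕜 E M)} {x : V} (hD : DerNear X D x) {a : A}
    (ha : (T.conn (restrictDer U D)).Near a ⟨x, h x.2⟩) : (T.connRes h X).Near a x := by
  filter_upwards [hD.eventually, ha.res] with y h1 h2
  rw [← h2]
  exact T.connRes_apply h h1

/-- The sections `Ψ(1 ⊗ v)` over `V`, for `v ∈ g`. -/
def psiConst (T : LocalTriv 𝕜 E g A U) (h : V ≤ U) :
    g →ₗ[𝕜] kernel 𝕜 (SmoothFun 𝕜 E V) (LocalSec 𝕜 E A V) where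
  toFun v := ⟨LocalSec.res h (T.Ψ (1 ⊗ₜ v) : LocalSec 𝕜 E A U),
    LocalSec.res_mem_kernel h (T.Ψ (1 ⊗ₜ v)).2⟩
  map_add' v w := by
    rw [TensorProduct.tmul_add, map_add]
    rfl
  map_smul' c v := by
    have : (1 : SmoothFun 𝕜 E U) ⊗ₜ[𝕜] (c • v) = algebraMap 𝕜 (SmoothFun 𝕜 E U) c • 1 ⊗ₜ[𝕜] v := by
      rw [TensorProduct.tmul_smul, algebraMap_smul]
    rw [this, map_smul]
    rfl

/-- The restriction of `Ψ` to `V`: the `C^∞(V)`-linear map `f ⊗ v ↦ f Ψ(1 ⊗ v)`. -/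
def psiRes (T : LocalTriv 𝕜 E g A U) (h : V ≤ U) :
    (SmoothFun 𝕜 E V ⊗[𝕜] g) →ₗ[SmoothFun 𝕜 E V]
      kernel 𝕜 (SmoothFun 𝕜 E V) (LocalSec 𝕜 E A V) :=
  LinearMap.liftBaseChange (SmoothFun 𝕜 E V) (T.psiConst h)

lemma psiRes_tmul (T : LocalTriv 𝕜 E g A U) (h : V ≤ U) (f : SmoothFun 𝕜 E V)
    (v : g) : T.psiRes h (f ⊗ₜ v) = f • T.psiConst h v := by
  simp [psiRes]

lemma psiRes_apply (T : LocalTriv 𝕜 E g A U) (h : V ≤ U) {ι : Type*} [Fintype ι]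
    (b : Module.Basis ι 𝕜 g) (γ : SmoothFun 𝕜 E V ⊗[𝕜] g) (x : V) :
    (T.psiRes h γ : LocalSec 𝕜 E A V) x =
      ∑ i, (Algebra.TensorProduct.basis (SmoothFun 𝕜 E V) b).repr γ i x •
        (T.Ψ (1 ⊗ₜ b i) : LocalSec 𝕜 E A U) ⟨x, h x.2⟩ := by
  conv_lhs => rw [← (Algebra.TensorProduct.basis (SmoothFun 𝕜 E V) b).sum_repr γ]
  simp only [map_sum, map_smul, Algebra.TensorProduct.basis_apply, psiRes_tmul, one_smul,
    Submodule.coe_sum, Submodule.coe_smul, LocalSec.sum_apply, LocalSec.fsmul_apply]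
  rfl

lemma Ψ_apply (T : LocalTriv 𝕜 E g A U) {ι : Type*} [Fintype ι]
    (b : Module.Basis ι 𝕜 g) (γ : SmoothFun 𝕜 E U ⊗[𝕜] g) (x : U) :
    (T.Ψ γ : LocalSec 𝕜 E A U) x =
      ∑ i, (Algebra.TensorProduct.basis (SmoothFun 𝕜 E U) b).repr γ i x •
        (T.Ψ (1 ⊗ₜ b i) : LocalSec 𝕜 E A U) x := by
  conv_lhs => rw [← (Algebra.TensorProduct.basis (SmoothFun 𝕜 E U) b).sum_repr γ]
  simp only [map_sum, map_smul, Algebra.TensorProduct.basis_apply,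
    Submodule.coe_sum, Submodule.coe_smul, LocalSec.sum_apply, LocalSec.fsmul_apply]

lemma psiRes_injective [FiniteDimensional 𝕜 g] (T : LocalTriv 𝕜 E g A U)
    (h : V ≤ U) : Function.Injective (T.psiRes h) := by
  rw [injective_iff_map_eq_zero]
  intro γ hγ
  let b := Module.finBasis 𝕜 g
  refine (Algebra.TensorProduct.basis (SmoothFun 𝕜 E V) b).repr.map_eq_zero_iff.1 ?_
  ext i x
  obtain ⟨φ, h1, h2⟩ := exists_bump (𝕜 := 𝕜) (E := E) (x : M) (V.isOpen.mem_nhds x.2)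
  let F := fun j => SmoothFun.restrict U
    (zeroExt V φ h2 ((Algebra.TensorProduct.basis (SmoothFun 𝕜 E V) b).repr γ j))
  let Γ : SmoothFun 𝕜 E U ⊗[𝕜] g :=
    ∑ j, F j • Algebra.TensorProduct.basis (SmoothFun 𝕜 E U) b j
  have hrepr : ∀ j, (Algebra.TensorProduct.basis (SmoothFun 𝕜 E U) b).repr Γ j = F j :=
    fun j => (Algebra.TensorProduct.basis (SmoothFun 𝕜 E U) b).repr_sum_self F ▸ rfl
  have hΓ : T.Ψ Γ = 0 := by
    refine Subtype.ext (LocalSec.ext fun y => ?_)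
    rw [T.Ψ_apply b]
    simp only [hrepr]
    change _ = 0
    by_cases hy : (y : M) ∈ V
    · have h3 := T.psiRes_apply h b γ ⟨y, hy⟩
      rw [hγ] at h3
      have h4 : ∀ j, F j y = φ y *
          (Algebra.TensorProduct.basis (SmoothFun 𝕜 E V) b).repr γ j ⟨y, hy⟩ := fun j =>
        zeroExt_apply V φ h2 _ ⟨y, hy⟩
      simp only [h4, mul_smul, ← Finset.smul_sum]
      rw [← h3]
      exact smul_zero _
    · have h4 : ∀ j, F j y = 0 := fun j => zeroExt_apply_of_notMem V φ h2 _ hy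
      simp only [h4, zero_smul, Finset.sum_const_zero]
  have hΓ0 : Γ = 0 := T.Ψ.map_eq_zero_iff.1 hΓ
  have h5 : F i ⟨x, h x.2⟩ = 0 := by
    rw [← hrepr i, hΓ0, map_zero]
    rfl
  have h6 : F i ⟨x, h x.2⟩ = φ x *
      (Algebra.TensorProduct.basis (SmoothFun 𝕜 E V) b).repr γ i x := zeroExt_apply V φ h2 _ x
  rw [h6, h1.self_of_nhds, one_mul] at h5
  exact h5

lemma coord_congr (T : LocalTriv 𝕜 E g A U) {ι : Type*} [Fintype ι]
    (b : Module.Basis ι 𝕜 g) {t t' : kernel 𝕜 (SmoothFun 𝕜 E U) (LocalSec 𝕜 E A U)} {y : U}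
    (ht : ∀ᶠ z in 𝓝 y, (t : LocalSec 𝕜 E A U) z = (t' : LocalSec 𝕜 E A U) z) (i : ι) :
    (Algebra.TensorProduct.basis (SmoothFun 𝕜 E U) b).repr (T.Ψ.symm t) i y =
      (Algebra.TensorProduct.basis (SmoothFun 𝕜 E U) b).repr (T.Ψ.symm t') i y := by
  obtain ⟨φ, h1, h2⟩ := exists_bump (𝕜 := 𝕜) (E := E) y ht
  have h3 : φ • t = φ • t' := by
    refine Subtype.ext (LocalSec.ext fun z => ?_)
    change φ z • (t : LocalSec 𝕜 E A U) z = φ z • (t' : LocalSec 𝕜 E A U) z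
    by_cases hz : (t : LocalSec 𝕜 E A U) z = (t' : LocalSec 𝕜 E A U) z
    · rw [hz]
    · have : φ z = 0 := image_eq_zero_of_notMem_tsupport (f := ⇑φ) fun hh => hz (h2 hh)
      rw [this, zero_smul, zero_smul]
  have h4 := congrArg (fun u => (Algebra.TensorProduct.basis (SmoothFun 𝕜 E U) b).repr
    (T.Ψ.symm u) i y) h3
  simp only [map_smul, Finsupp.smul_apply, smul_eq_mul, SmoothFun.mul_apply, h1.self_of_nhds,
    one_mul] at h4
  exact h4

lemma psiRes_surjective [FiniteDimensional 𝕜 g] (T : LocalTriv 𝕜 E g A U)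
    (h : V ≤ U) : Function.Surjective (T.psiRes h) := by
  intro s
  let b := Module.finBasis 𝕜 g
  choose φ h1 h2 using fun x : V =>
    exists_bump (𝕜 := 𝕜) (E := E) (x : M) (V.isOpen.mem_nhds x.2)
  let t : V → kernel 𝕜 (SmoothFun 𝕜 E U) (LocalSec 𝕜 E A U) := fun x =>
    ⟨LocalSec.zeroExt h (φ x) (h2 x) (s : LocalSec 𝕜 E A V), LocalSec.zeroExt_mem_kernel h (φ x) (h2 x) s.2⟩
  have ht : ∀ x y : V, (t x : LocalSec 𝕜 E A U) ⟨y, h y.2⟩ = φ x y • (s : LocalSec 𝕜 E A V) y :=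
    fun x y => LocalSec.zeroExt_apply h (φ x) (h2 x) (s : LocalSec 𝕜 E A V) y
  let c := fun (x : V) (i : Fin (Module.finrank 𝕜 g)) =>
    (Algebra.TensorProduct.basis (SmoothFun 𝕜 E U) b).repr (T.Ψ.symm (t x)) i
  have hc : ∀ x i, ∀ᶠ y in 𝓝 x, c y i ⟨y, h y.2⟩ = SmoothFun.res h (c x i) y := by
    intro x i
    have e1 : ∀ᶠ y : V in 𝓝 x, φ x y = 1 := continuous_subtype_val.continuousAt.eventually (h1 x)
    filter_upwards [eventually_eventually_nhds.2 e1] with y hy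
    refine T.coord_congr b ?_ i
    have hopen : Topology.IsOpenEmbedding (Set.inclusion h : V → U) :=
      Opens.isOpenEmbedding_of_le h
    have e2 : ∀ᶠ z : V in 𝓝 y, φ y z = 1 := continuous_subtype_val.continuousAt.eventually (h1 y)
    have e3 := hopen.map_nhds_eq y
    change ∀ᶠ z in 𝓝 (Set.inclusion h y), _
    rw [← e3, eventually_map]
    filter_upwards [hy, e2] with z h3 h4
    exact (ht y z).trans ((by rw [h3, h4] : _ = φ x z • (s : LocalSec 𝕜 E A V) z).trans
      (ht x z).symm)
  let f := fun i => SmoothFun.mk (𝕜 := 𝕜) (E := E) (fun x : V => c x i ⟨x, h x.2⟩)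
    (smoothFun_of_local fun x => ⟨SmoothFun.res h (c x i), hc x i⟩)
  refine ⟨∑ i, f i • Algebra.TensorProduct.basis (SmoothFun 𝕜 E V) b i, ?_⟩
  refine Subtype.ext (LocalSec.ext fun x => ?_)
  rw [T.psiRes_apply h b, (Algebra.TensorProduct.basis (SmoothFun 𝕜 E V) b).repr_sum_self]
  have h5 := T.Ψ_apply b (T.Ψ.symm (t x)) ⟨x, h x.2⟩
  rw [LinearEquiv.apply_symm_apply, ht x x, (h1 x).self_of_nhds, one_smul] at h5
  exact h5.symm

lemma kernel_lie_smul {a b : LocalSec 𝕜 E A V} (ha : a ∈ kernel 𝕜 (SmoothFun 𝕜 E V) (LocalSec 𝕜 E A V))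
    (f : SmoothFun 𝕜 E V) : ⁅a, f • b⁆ = f • ⁅a, b⁆ := by
  rw [LieRinehartRing.leibniz_smul_right, mem_kernel.1 ha, zero_smul, add_zero]

lemma psiRes_lie (T : LocalTriv 𝕜 E g A U) (h : V ≤ U)
    (γ η : SmoothFun 𝕜 E V ⊗[𝕜] g) :
    ⁅(T.psiRes h γ : LocalSec 𝕜 E A V), (T.psiRes h η : LocalSec 𝕜 E A V)⁆
      = T.psiRes h ⁅γ, η⁆ := by
  induction γ with
  | zero => simp
  | add γ γ' h1 h2 => simp only [map_add, add_lie, Submodule.coe_add, h1, h2]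
  | tmul f v =>
    induction η with
    | zero => simp
    | add η η' h1 h2 => simp only [map_add, lie_add, Submodule.coe_add, h1, h2]
    | tmul f' w =>
      rw [LieAlgebra.ExtendScalars.bracket_tmul, psiRes_tmul, psiRes_tmul, psiRes_tmul,
        Submodule.coe_smul, Submodule.coe_smul, Submodule.coe_smul,
        kernel_lie_smul (Submodule.smul_mem _ _ (T.psiConst h v).2), ← lie_skew,
        kernel_lie_smul (T.psiConst h w).2, ← smul_neg, lie_skew, smul_smul, mul_comm]
      change _ • ⁅LocalSec.res h _, LocalSec.res h _⁆ = _ • LocalSec.res h _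
      rw [← LocalSec.res_lie, T.Ψ_lie, LieAlgebra.ExtendScalars.bracket_tmul, one_mul]

lemma act_connRes (T : LocalTriv 𝕜 E g A U) (h : V ≤ U)
    (X : Derivation 𝕜 (SmoothFun 𝕜 E V) (SmoothFun 𝕜 E V)) (f : SmoothFun 𝕜 E V) :
    ⁅T.connRes h X, f⁆ = X f := by
  ext x
  obtain ⟨D, hD⟩ := exists_derNear X x
  obtain ⟨a, ha⟩ := (T.conn (restrictDer U D)).exists_near ⟨x, h x.2⟩
  obtain ⟨F, hF⟩ := exists_ext V f x
  rw [(T.connRes_near h hD ha).act_apply hF, hD.apply hF, ← ha.act_restrict F,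
    ← LieRinehartAlgebra.anchor_apply (R := 𝕜), T.anchor_conn, restrictDer_restrict]
  rfl

lemma connRes_psiRes (T : LocalTriv 𝕜 E g A U) (h : V ≤ U)
    (X : Derivation 𝕜 (SmoothFun 𝕜 E V) (SmoothFun 𝕜 E V)) (γ : SmoothFun 𝕜 E V ⊗[𝕜] g) :
    ⁅T.connRes h X, (T.psiRes h γ : LocalSec 𝕜 E A V)⁆ = T.psiRes h (derAct g X γ) := by
  induction γ with
  | zero => simp
  | add γ γ' h1 h2 => simp only [map_add, lie_add, Submodule.coe_add, h1, h2]
  | tmul f v =>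
    have h0 : ⁅T.connRes h X, (T.psiConst h v : LocalSec 𝕜 E A V)⁆ = 0 := by
      ext x
      obtain ⟨D, hD⟩ := exists_derNear X x
      obtain ⟨a, ha⟩ := (T.conn (restrictDer U D)).exists_near ⟨x, h x.2⟩
      obtain ⟨b, hb⟩ := (T.Ψ (1 ⊗ₜ v) : LocalSec 𝕜 E A U).exists_near ⟨x, h x.2⟩
      have hb' : (T.psiConst h v : LocalSec 𝕜 E A V).Near b x := hb.res
      rw [(T.connRes_near h hD ha).lie_apply hb', ← ha.lie_apply hb, T.conn_Ψ, derAct_tmul,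
        Derivation.map_one_eq_zero, TensorProduct.zero_tmul, map_zero]
      rfl
    rw [derAct_tmul, psiRes_tmul, psiRes_tmul, Submodule.coe_smul, Submodule.coe_smul,
      LieRinehartRing.leibniz_smul_right, h0, smul_zero, zero_add, T.act_connRes h X f]

lemma psiRes_bijective [FiniteDimensional 𝕜 g] (T : LocalTriv 𝕜 E g A U)
    (h : V ≤ U) : Function.Bijective (T.psiRes h) :=
  ⟨T.psiRes_injective h, T.psiRes_surjective h⟩

/-- The restriction of `Ψ` to `V`, as an isomorphism. -/
def psiEquiv [FiniteDimensional 𝕜 g] (T : LocalTriv 𝕜 E g A U) (h : V ≤ U) :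
    (SmoothFun 𝕜 E V ⊗[𝕜] g) ≃ₗ[SmoothFun 𝕜 E V]
      kernel 𝕜 (SmoothFun 𝕜 E V) (LocalSec 𝕜 E A V) :=
  LinearEquiv.ofBijective (T.psiRes h) (T.psiRes_bijective h)

lemma psiEquiv_apply [FiniteDimensional 𝕜 g] (T : LocalTriv 𝕜 E g A U) (h : V ≤ U)
    (γ : SmoothFun 𝕜 E V ⊗[𝕜] g) : T.psiEquiv h γ = T.psiRes h γ := rfl

/-- The restriction of `∇⁰` to `V`, as a linear map. -/
def connLin (T : LocalTriv 𝕜 E g A U) (h : V ≤ U) :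
    Derivation 𝕜 (SmoothFun 𝕜 E V) (SmoothFun 𝕜 E V) →ₗ[SmoothFun 𝕜 E V] LocalSec 𝕜 E A V where
  toFun := T.connRes h
  map_add' X Y := by
    ext x
    obtain ⟨D, hD⟩ := exists_derNear X x
    obtain ⟨D', hD'⟩ := exists_derNear Y x
    rw [LocalSec.add_apply, T.connRes_apply h hD, T.connRes_apply h hD',
      T.connRes_apply h (hD.add hD'), restrictDer_add, map_add, LocalSec.add_apply]
  map_smul' f X := by
    ext x
    obtain ⟨D, hD⟩ := exists_derNear X x
    obtain ⟨F, hF⟩ := exists_ext V f x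
    rw [RingHom.id_apply, LocalSec.fsmul_apply, T.connRes_apply h hD,
      T.connRes_apply h (hD.smul hF), restrictDer_smul, map_smul, LocalSec.fsmul_apply,
      hF.self_of_nhds]
    rfl

lemma connLin_apply (T : LocalTriv 𝕜 E g A U) (h : V ≤ U)
    (X : Derivation 𝕜 (SmoothFun 𝕜 E V) (SmoothFun 𝕜 E V)) : T.connLin h X = T.connRes h X := rfl

lemma connRes_lie (T : LocalTriv 𝕜 E g A U) (h : V ≤ U)
    (X Y : Derivation 𝕜 (SmoothFun 𝕜 E V) (SmoothFun 𝕜 E V)) :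
    ⁅T.connRes h X, T.connRes h Y⁆ = T.connRes h ⁅X, Y⁆ := by
  ext x
  obtain ⟨D, hD⟩ := exists_derNear X x
  obtain ⟨D', hD'⟩ := exists_derNear Y x
  obtain ⟨a, ha⟩ := (T.conn (restrictDer U D)).exists_near ⟨x, h x.2⟩
  obtain ⟨b, hb⟩ := (T.conn (restrictDer U D')).exists_near ⟨x, h x.2⟩
  rw [(T.connRes_near h hD ha).lie_apply (T.connRes_near h hD' hb),
    T.connRes_apply h (hD.lie hD'), restrictDer_lie, ← T.conn_lie, ha.lie_apply hb]

/-- The restriction `(V, Ψ|_V, ∇⁰|_V)` of a local trivialization to a smaller open set `V`. -/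
def restrict [FiniteDimensional 𝕜 g] (T : LocalTriv 𝕜 E g A U) (h : V ≤ U) :
    LocalTriv 𝕜 E g A V where
  Ψ := T.psiEquiv h
  conn := T.connLin h
  Ψ_lie γ η := by
    rw [psiEquiv_apply, psiEquiv_apply, psiEquiv_apply, T.psiRes_lie h γ η]
  conn_lie X Y := by
    rw [connLin_apply, connLin_apply, connLin_apply, T.connRes_lie h X Y]
  anchor_conn X := by
    ext f x
    rw [connLin_apply, LieRinehartAlgebra.anchor_apply, T.act_connRes h X f]
  conn_Ψ X γ := by
    rw [psiEquiv_apply, psiEquiv_apply, connLin_apply, T.connRes_psiRes h X γ]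

/-- For local trivializations `T` over `U` and `T'` over `U'`: the change of trivialization from `T'`
to `T` on `Ω^q_TLA(U ∩ U', g)`. -/
def changeTriv [FiniteDimensional 𝕜 g] {U' : Opens M} (T : LocalTriv 𝕜 E g A U)
    (T' : LocalTriv 𝕜 E g A U') (q : ℕ) :
    TLAForm 𝕜 (SmoothFun 𝕜 E ↥(U ⊓ U')) g q →ₗ[SmoothFun 𝕜 E ↥(U ⊓ U')]
      TLAForm 𝕜 (SmoothFun 𝕜 E ↥(U ⊓ U')) g q :=
  alphaHat (T.restrict inf_le_left) (T'.restrict inf_le_right) q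

end LocalTriv

end restrict

end local_theory

end

end LieAlgd

open LieAlgd

/-!
The differentials `d̂` and `d_TLA` are both Koszul differentials: `d_TLA = d + s'` is the Koszul
differential of the sum of the data that define `d` and `s'`. The Koszul formula involves nothing
but the bracket, the action and sums, so any correspondence between the arguments of two forms that
respects brackets, actions and the values of the forms also respects their differentials. For the
correspondence between the sections of `A_U` and the elements of `A` that agree with them near a
point, this shows that `d̂` commutes with restriction to `U`; for the graph of `S`, it shows that
`d̂` on `A_U` becomes `d_TLA` under `η ↦ Ψ⁻¹ ∘ η ∘ S`. The latter map is bijective and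
`α̂ = (Ψ⁻¹ ∘ · ∘ S) ∘ (Ψ'⁻¹ ∘ · ∘ S')⁻¹`, whence the compatibility of `α̂` with `d_TLA`;
compatibility with the bracket of forms holds because the exterior product is natural and `α` is a
morphism of Lie algebras.
-/

namespace LieAlgd

noncomputable section

section exteriorProduct

variable {R ιa ιb M M' N₁ N₂ P₁ P₂ : Type*} [CommSemiring R]
  [Fintype ιa] [Fintype ιb] [DecidableEq ιa] [DecidableEq ιb]
  [AddCommMonoid M] [Module R M] [AddCommMonoid M'] [Module R M']
  [AddCommGroup N₁] [Module R N₁] [AddCommGroup N₂] [Module R N₂]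
  [AddCommGroup P₁] [Module R P₁] [AddCommGroup P₂] [Module R P₂]

lemma domCoprod_compLinearMap (a : M [⋀^ιa]→ₗ[R] N₁) (b : M [⋀^ιb]→ₗ[R] N₂) (s : M' →ₗ[R] M) :
    (a.compLinearMap s).domCoprod (b.compLinearMap s) = (a.domCoprod b).compLinearMap s := by
  ext v
  simp only [AlternatingMap.compLinearMap_apply, AlternatingMap.domCoprod_apply,
    sum_apply]
  refine Finset.sum_congr rfl fun σ _ => ?_
  induction σ using Quotient.inductionOn'
  rfl

lemma domCoprod_compAlternatingMap (f₁ : N₁ →ₗ[R] P₁) (f₂ : N₂ →ₗ[R] P₂)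
    (a : M [⋀^ιa]→ₗ[R] N₁) (b : M [⋀^ιb]→ₗ[R] N₂) :
    (f₁.compAlternatingMap a).domCoprod (f₂.compAlternatingMap b) =
      (TensorProduct.map f₁ f₂).compAlternatingMap (a.domCoprod b) := by
  ext v
  simp only [LinearMap.compAlternatingMap_apply, AlternatingMap.domCoprod_apply,
    sum_apply, map_sum]
  refine Finset.sum_congr rfl fun σ _ => ?_
  induction σ using Quotient.inductionOn' with | _ σ
  simp only [AlternatingMap.domCoprod.summand_mk'']
  rcases Int.units_eq_one_or (Equiv.Perm.sign σ) with hσ | hσ <;> rw [hσ] <;> simp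

end exteriorProduct

namespace KoszulDatum

variable {𝕜 R A W : Type*} [Field 𝕜] [CommRing R] [Algebra 𝕜 R]
  [AddCommGroup A] [Module 𝕜 A] [Module R A] [AddCommGroup W] [Module 𝕜 W] [Module R W]

/-- The sum of two Koszul data on the same modules, whose differential is the sum of theirs. -/
instance : Add (KoszulDatum 𝕜 R A W) where
  add K K' :=
    { anchor := fun X => K.anchor X + K'.anchor X
      br := K.br + K'.br
      act := K.act + K'.act
      br_self := fun X => by simp [K.br_self, K'.br_self]
      br_smul := fun X Y f => by
        simp only [LinearMap.add_apply, K.br_smul, K'.br_smul, Derivation.add_apply, add_smul,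
          smul_add]
        abel
      act_smul_left := fun f X w => by simp [K.act_smul_left, K'.act_smul_left]
      act_smul := fun X f w => by
        simp only [LinearMap.add_apply, K.act_smul, K'.act_smul, Derivation.add_apply, add_smul,
          smul_add]
        abel }

lemma add_br (K K' : KoszulDatum 𝕜 R A W) : (K + K').br = K.br + K'.br := rfl

lemma add_act (K K' : KoszulDatum 𝕜 R A W) : (K + K').act = K.act + K'.act := rfl

variable [CharZero 𝕜] [IsScalarTower 𝕜 R A] [IsScalarTower 𝕜 R W]

lemma d_apply (K : KoszulDatum 𝕜 R A W) {q : ℕ} (θ : A [⋀^Fin q]→ₗ[R] W) (X : Fin (q + 1) → A) :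
    K.d θ X = ∑ i : Fin (q + 1), (-1) ^ (i : ℕ) • K.act (X i) (θ (i.removeNth X))
      - (2⁻¹ : 𝕜) • ∑ i : Fin (q + 1), (-1) ^ (i : ℕ) •
        ∑ k, θ (Function.update (i.removeNth X) k (K.br (X i) (i.removeNth X k))) := rfl

lemma add_d (K K' : KoszulDatum 𝕜 R A W) {q : ℕ} (θ : A [⋀^Fin q]→ₗ[R] W) :
    (K + K').d θ = K.d θ + K'.d θ := by
  ext X
  simp only [AlternatingMap.add_apply, d_apply, add_br, add_act, LinearMap.add_apply,
    θ.map_update_add, smul_add, Finset.sum_add_distrib]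
  abel

lemma map_d_eq_map_d {R' A' W' P : Type*} [CommRing R'] [Algebra 𝕜 R']
    [AddCommGroup A'] [Module 𝕜 A'] [Module R' A'] [IsScalarTower 𝕜 R' A']
    [AddCommGroup W'] [Module 𝕜 W'] [Module R' W'] [IsScalarTower 𝕜 R' W']
    [AddCommGroup P] [Module 𝕜 P]
    {K : KoszulDatum 𝕜 R A W} {K' : KoszulDatum 𝕜 R' A' W'} {r : A → A' → Prop}
    {e : W →ₗ[𝕜] P} {e' : W' →ₗ[𝕜] P}
    {q : ℕ} {θ : A [⋀^Fin q]→ₗ[R] W} {θ' : A' [⋀^Fin q]→ₗ[R'] W'}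
    (hbr : ∀ {X X' Y Y'}, r X X' → r Y Y' → r (K.br X Y) (K'.br X' Y'))
    (hact : ∀ {X X' Y Y'}, r X X' → (∀ k, r (Y k) (Y' k)) →
      e (K.act X (θ Y)) = e' (K'.act X' (θ' Y')))
    (hθ : ∀ {Y Y'}, (∀ k, r (Y k) (Y' k)) → e (θ Y) = e' (θ' Y'))
    {X : Fin (q + 1) → A} {X' : Fin (q + 1) → A'} (hX : ∀ i, r (X i) (X' i)) :
    e (K.d θ X) = e' (K'.d θ' X') := by
  have hremove : ∀ (i : Fin (q + 1)) (k : Fin q), r (i.removeNth X k) (i.removeNth X' k) :=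
    fun _ _ => hX _
  have hact_term : ∀ i : Fin (q + 1), e (K.act (X i) (θ (i.removeNth X))) =
      e' (K'.act (X' i) (θ' (i.removeNth X'))) := fun i => hact (hX i) (hremove i)
  have hbr_term : ∀ (i : Fin (q + 1)) (k : Fin q),
      e (θ (Function.update (i.removeNth X) k (K.br (X i) (i.removeNth X k)))) =
        e' (θ' (Function.update (i.removeNth X') k (K'.br (X' i) (i.removeNth X' k)))) := by
    refine fun i k => hθ fun l => ?_
    rcases eq_or_ne l k with rfl | hl
    · simpa only [Function.update_self] using hbr (hX i) (hremove i l)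
    · simpa only [Function.update_of_ne hl] using hremove i l
  simp only [d_apply, map_sub, map_sum, map_smul, map_zsmul, hact_term, hbr_term]

end KoszulDatum

section adjoint

variable {𝕜 R A : Type*} [Field 𝕜] [CommRing R] [Algebra 𝕜 R] [LieRing A] [LieAlgebra 𝕜 A]
  [Module R A] [LieRingModule A R] [LieRinehartRing R A] [LieRinehartAlgebra 𝕜 R A]

lemma adjointDatum_br_apply (X Y : A) : (adjointDatum 𝕜 R A).br X Y = ⁅X, Y⁆ := rfl

lemma coe_adjointDatum_act_apply (X : A) (w : kernel 𝕜 R A) :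
    ((adjointDatum 𝕜 R A).act X w : A) = ⁅X, (w : A)⁆ := rfl

end adjoint

section trivialAlgebroid

variable {𝕜 R g : Type*} [Field 𝕜] [CommRing R] [Algebra 𝕜 R] [LieRing g] [LieAlgebra 𝕜 g]

variable (𝕜 R g) in
/-- The bracket and anchor of the trivial Lie algebroid, with its action
`(X ⊕ γ) · η = X · η + [γ, η]` on `g`-valued functions. -/
def tlaDatum : KoszulDatum 𝕜 R (TLA 𝕜 R g) (R ⊗[𝕜] g) :=
  deRhamDatum 𝕜 R g + chevalleyEilenbergDatum 𝕜 R g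

lemma tlaDatum_br_apply (X Y : TLA 𝕜 R g) :
    (tlaDatum 𝕜 R g).br X Y =
      (⁅X.1, Y.1⁆, derAct g X.1 Y.2 - derAct g Y.1 X.2 + ⁅X.2, Y.2⁆) :=
  Prod.ext (add_zero _) rfl

lemma tlaDatum_act_apply (X : TLA 𝕜 R g) (γ : R ⊗[𝕜] g) :
    (tlaDatum 𝕜 R g).act X γ = derAct g X.1 γ + ⁅X.2, γ⁆ := rfl

lemma dTLA_eq_tlaDatum_d [CharZero 𝕜] {q : ℕ} (θ : TLAForm 𝕜 R g q) :
    dTLA θ = (tlaDatum 𝕜 R g).d θ :=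
  (KoszulDatum.add_d _ _ θ).symm

lemma formBracket_compLinearMap {p q : ℕ} (θ : TLAForm 𝕜 R g p) (η : TLAForm 𝕜 R g q)
    (s : TLA 𝕜 R g →ₗ[R] TLA 𝕜 R g) :
    formBracket (θ.compLinearMap s) (η.compLinearMap s) = (formBracket θ η).compLinearMap s := by
  rw [formBracket, domCoprod_compLinearMap]
  rfl

lemma formBracket_compAlternatingMap {p q : ℕ} {α : R ⊗[𝕜] g →ₗ[R] R ⊗[𝕜] g}
    (hα : ∀ γ δ, α ⁅γ, δ⁆ = ⁅α γ, α δ⁆) (θ : TLAForm 𝕜 R g p) (η : TLAForm 𝕜 R g q) :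
    formBracket (α.compAlternatingMap θ) (α.compAlternatingMap η) =
      α.compAlternatingMap (formBracket θ η) := by
  let bracket : (R ⊗[𝕜] g) ⊗[R] (R ⊗[𝕜] g) →ₗ[R] R ⊗[𝕜] g :=
    TensorProduct.lift (LinearMap.mk₂ R (fun γ δ => ⁅γ, δ⁆) add_lie smul_lie lie_add
      fun f γ δ => lie_smul f γ δ)
  have bracket_map : bracket ∘ₗ TensorProduct.map α α = α ∘ₗ bracket :=
    TensorProduct.ext' fun γ δ => (hα γ δ).symm
  rw [formBracket, domCoprod_compAlternatingMap]
  ext X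
  exact LinearMap.congr_fun bracket_map _

end trivialAlgebroid

section localTheory

variable {𝕜 E M A : Type*} [RCLike 𝕜] [NormedAddCommGroup E] [NormedSpace ℝ E]
  [FiniteDimensional ℝ E]
  [TopologicalSpace M] [ChartedSpace E M] [IsManifold 𝓘(ℝ, E) ∞ M] [T2Space M]
  [LieRing A] [LieAlgebra 𝕜 A] [Module (SmoothFun 𝕜 E M) A]
  [LieRingModule A (SmoothFun 𝕜 E M)] [LieRinehartRing (SmoothFun 𝕜 E M) A]
  [LieRinehartAlgebra 𝕜 (SmoothFun 𝕜 E M) A] [Module.Projective (SmoothFun 𝕜 E M) A]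

namespace LocalSec

variable {V : Opens M}

/-- The value at `x` of a section with values in the kernel, as a `𝕜`-linear map. -/
def kernelEval (x : V) :
    kernel 𝕜 (SmoothFun 𝕜 E V) (LocalSec 𝕜 E A V) →ₗ[𝕜] Fiber 𝕜 E A (x : M) where
  toFun s := (s : LocalSec 𝕜 E A V) x
  map_add' _ _ := rfl
  map_smul' _ _ := rfl

variable (𝕜 E A) in
/-- The value at `x` of an element of the kernel of `A`, as a `𝕜`-linear map. -/
def kernelFval (x : M) : kernel 𝕜 (SmoothFun 𝕜 E M) A →ₗ[𝕜] Fiber 𝕜 E A x where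
  toFun a := fval 𝕜 E x a
  map_add' _ _ := map_add _ _ _
  map_smul' _ _ := fval_smul _ _ _

lemma dHat_restrictForm {q : ℕ} (θ : KForm 𝕜 (SmoothFun 𝕜 E M) A q) :
    dHat (restrictForm V θ) = restrictForm V (dHat θ) := by
  ext1 s
  refine Subtype.ext (LocalSec.ext fun x => ?_)
  choose a ha using fun k => (s k).exists_near x
  calc (dHat (restrictForm V θ) s : LocalSec 𝕜 E A V) x
      = fval 𝕜 E (x : M) (dHat θ a : A) :=
        KoszulDatum.map_d_eq_map_d (r := fun s a => s.Near a x)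
          (e := kernelEval x) (e' := kernelFval 𝕜 E A (x : M))
          Near.lie (fun hs hY => hs.lie_apply (formVal_near θ hY))
          (fun hY => formVal_apply θ fun k => (hY k).eq) ha
    _ = (restrictForm V (dHat θ) s : LocalSec 𝕜 E A V) x :=
        (formVal_apply (dHat θ) fun k => (ha k).eq).symm

end LocalSec

namespace LocalTriv

variable {g : Type*} [LieRing g] [LieAlgebra 𝕜 g] {U : Opens M} (T T' : LocalTriv 𝕜 E g A U)
  {q : ℕ}

/-- The isomorphism `η ↦ Ψ⁻¹ ∘ η ∘ S` from the forms on `A_U` with values in its kernel to the forms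
on the trivial Lie algebroid. -/
def formEquiv (q : ℕ) :
    KForm 𝕜 (SmoothFun 𝕜 E U) (LocalSec 𝕜 E A U) q ≃ₗ[SmoothFun 𝕜 E U]
      TLAForm 𝕜 (SmoothFun 𝕜 E U) g q :=
  AlternatingMap.domLCongr _ _ _ _ T.S.symm ≪≫ₗ T.Ψ.symm.alternatingMapCongrRight

lemma formEquiv_apply (η : KForm 𝕜 (SmoothFun 𝕜 E U) (LocalSec 𝕜 E A U) q)
    (X : Fin q → TLA 𝕜 (SmoothFun 𝕜 E U) g) :
    T.formEquiv q η X = T.Ψ.symm (η fun k => T.S (X k)) := rfl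

lemma localForm_eq_formEquiv (θ : KForm 𝕜 (SmoothFun 𝕜 E M) A q) :
    T.localForm θ = T.formEquiv q (LocalSec.restrictForm U θ) := rfl

lemma S_apply (X : TLA 𝕜 (SmoothFun 𝕜 E U) g) :
    T.S X = T.conn X.1 + (T.Ψ X.2 : LocalSec 𝕜 E A U) := rfl

lemma S_br (X Y : TLA 𝕜 (SmoothFun 𝕜 E U) g) :
    T.S ((tlaDatum 𝕜 (SmoothFun 𝕜 E U) g).br X Y) = ⁅T.S X, T.S Y⁆ := by
  have Ψ_conn : ⁅(T.Ψ X.2 : LocalSec 𝕜 E A U), T.conn Y.1⁆ = -(T.Ψ (derAct g Y.1 X.2)) := by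
    rw [← lie_skew, T.conn_Ψ]
  simp only [S_apply, tlaDatum_br_apply, add_lie, lie_add, T.conn_lie, T.conn_Ψ, T.Ψ_lie, Ψ_conn,
    map_add, map_sub, Submodule.coe_add, Submodule.coe_sub]
  abel

lemma Ψ_act (X : TLA 𝕜 (SmoothFun 𝕜 E U) g) (γ : SmoothFun 𝕜 E U ⊗[𝕜] g) :
    T.Ψ ((tlaDatum 𝕜 (SmoothFun 𝕜 E U) g).act X γ) =
      (adjointDatum 𝕜 (SmoothFun 𝕜 E U) (LocalSec 𝕜 E A U)).act (T.S X) (T.Ψ γ) := by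
  refine Subtype.ext ?_
  rw [coe_adjointDatum_act_apply, tlaDatum_act_apply, S_apply, add_lie, T.conn_Ψ, T.Ψ_lie,
    map_add, Submodule.coe_add]

lemma dTLA_formEquiv (η : KForm 𝕜 (SmoothFun 𝕜 E U) (LocalSec 𝕜 E A U) q) :
    dTLA (T.formEquiv q η) = T.formEquiv (q + 1) (dHat η) := by
  have Ψ_formEquiv : ∀ {X : Fin q → TLA 𝕜 (SmoothFun 𝕜 E U) g} {Y : Fin q → LocalSec 𝕜 E A U},
      (∀ k, T.S (X k) = Y k) → T.Ψ (T.formEquiv q η X) = η Y := fun {X Y} h => by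
    rw [formEquiv_apply, LinearEquiv.apply_symm_apply, funext h]
  ext1 X
  rw [dTLA_eq_tlaDatum_d, formEquiv_apply, LinearEquiv.eq_symm_apply]
  exact KoszulDatum.map_d_eq_map_d (K := tlaDatum 𝕜 (SmoothFun 𝕜 E U) g)
    (K' := adjointDatum 𝕜 (SmoothFun 𝕜 E U) (LocalSec 𝕜 E A U)) (r := fun X Y => T.S X = Y)
    (e := T.Ψ.toLinearMap.restrictScalars 𝕜) (e' := LinearMap.id)
    (θ := T.formEquiv q η) (θ' := η)
    (fun hX hY => by rw [S_br, hX, hY, adjointDatum_br_apply])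
    (fun hX hY => by simp [Ψ_act, hX, Ψ_formEquiv hY])
    Ψ_formEquiv fun _ => rfl

lemma dTLA_localForm (θ : KForm 𝕜 (SmoothFun 𝕜 E M) A q) :
    dTLA (T.localForm θ) = T.localForm (dHat θ) := by
  rw [localForm_eq_formEquiv, dTLA_formEquiv, LocalSec.dHat_restrictForm, localForm_eq_formEquiv]

lemma alphaHat_eq_symm_trans :
    alphaHat T T' q = ((T'.formEquiv q).symm ≪≫ₗ T.formEquiv q : _ →ₗ[SmoothFun 𝕜 E U] _) :=
  rfl

lemma alphaHat_formEquiv (η : KForm 𝕜 (SmoothFun 𝕜 E U) (LocalSec 𝕜 E A U) q) :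
    alphaHat T T' q (T'.formEquiv q η) = T.formEquiv q η := by
  simp [alphaHat_eq_symm_trans]

lemma dTLA_localForm_eq_alphaHat (θ : KForm 𝕜 (SmoothFun 𝕜 E M) A q) :
    dTLA (T.localForm θ) = alphaHat T T' (q + 1) (dTLA (T'.localForm θ)) := by
  simp only [localForm_eq_formEquiv, dTLA_formEquiv, alphaHat_formEquiv]

lemma alpha_lie (γ δ : SmoothFun 𝕜 E U ⊗[𝕜] g) :
    alpha T T' ⁅γ, δ⁆ = ⁅alpha T T' γ, alpha T T' δ⁆ := by
  refine T.Ψ.injective (Subtype.ext ?_)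
  rw [← T.Ψ_lie]
  simp [alpha, T'.Ψ_lie]

lemma isGradedDiffLieIso_alphaHat :
    IsGradedDiffLieIso 𝕜 (SmoothFun 𝕜 E U) g fun q => alphaHat T T' q where
  bijective q := by
    rw [alphaHat_eq_symm_trans]
    exact LinearEquiv.bijective _
  map_bracket p q θ η :=
    calc alphaHat T T' (p + q) (formBracket θ η)
        = (alpha T T').toLinearMap.compAlternatingMap
          (formBracket (θ.compLinearMap (transition T T').toLinearMap)
            (η.compLinearMap (transition T T').toLinearMap)) := by
          rw [formBracket_compLinearMap]
          rfl
      _ = formBracket (alphaHat T T' p θ) (alphaHat T T' q η) :=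
          (formBracket_compAlternatingMap (alpha_lie T T') _ _).symm
  map_d q θ := by
    obtain ⟨η, rfl⟩ := (T'.formEquiv q).surjective θ
    rw [dTLA_formEquiv, alphaHat_formEquiv, alphaHat_formEquiv, dTLA_formEquiv]

end LocalTriv

end localTheory

end

end LieAlgd

theorem mainTheorem2_general {𝕜 E M g A ι : Type*} [RCLike 𝕜]
    [NormedAddCommGroup E] [NormedSpace ℝ E] [FiniteDimensional ℝ E]
    [TopologicalSpace M] [ChartedSpace E M] [IsManifold 𝓘(ℝ, E) ∞ M] [T2Space M]
    [LieRing g] [LieAlgebra 𝕜 g] [FiniteDimensional 𝕜 g]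
    [LieRing A] [LieAlgebra 𝕜 A] [Module (SmoothFun 𝕜 E M) A]
    [LieRingModule A (SmoothFun 𝕜 E M)] [LieRinehartRing (SmoothFun 𝕜 E M) A]
    [LieRinehartAlgebra 𝕜 (SmoothFun 𝕜 E M) A] [Module.Projective (SmoothFun 𝕜 E M) A]
    (U : ι → Opens M) (T : ∀ i, LocalTriv 𝕜 E g A (U i)) :
    (∀ (i : ι) (q : ℕ) (θ : KForm 𝕜 (SmoothFun 𝕜 E M) A q),
      dTLA ((T i).localForm θ) = (T i).localForm (dHat θ)) ∧
    (∀ (i j : ι) (q : ℕ) (θ : KForm 𝕜 (SmoothFun 𝕜 E M) A q),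
      dTLA (((T i).restrict inf_le_left : LocalTriv 𝕜 E g A (U i ⊓ U j)).localForm θ) =
        (T i).changeTriv (T j) (q + 1)
          (dTLA (((T j).restrict inf_le_right : LocalTriv 𝕜 E g A (U i ⊓ U j)).localForm θ))) ∧
    (∀ i j : ι, IsGradedDiffLieIso 𝕜 (SmoothFun 𝕜 E ↥(U i ⊓ U j)) g
      fun q => (T i).changeTriv (T j) q) :=
  ⟨fun i _ θ => (T i).dTLA_localForm θ,
    fun _ _ _ θ => LocalTriv.dTLA_localForm_eq_alphaHat _ _ θ,
    fun _ _ => LocalTriv.isGradedDiffLieIso_alphaHat _ _⟩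

/-- Let `A` be a transitive Lie algebroid over `M` and `T i` a family of local trivializations of `A`
over open sets `U i` (for instance an atlas). Then `d_TLA θ_loc = Ψ⁻¹ ∘ (d̂ θ) ∘ S` for every form `θ`
with values in the kernel; on `U i ∩ U j` the local expressions satisfy
`d_TLA θ_locⁱ = α̂ⁱⱼ (d_TLA θ_locʲ)`; and `α̂ⁱⱼ` is an isomorphism of graded differential Lie
algebras. -/
theorem mainTheorem2 {𝕜 E M g A ι : Type*} [RCLike 𝕜]
    [NormedAddCommGroup E] [NormedSpace ℝ E] [FiniteDimensional ℝ E]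
    [TopologicalSpace M] [ChartedSpace E M] [IsManifold 𝓘(ℝ, E) ∞ M] [T2Space M]
    [LieRing g] [LieAlgebra 𝕜 g] [FiniteDimensional 𝕜 g]
    [LieRing A] [LieAlgebra 𝕜 A] [Module (SmoothFun 𝕜 E M) A]
    [LieRingModule A (SmoothFun 𝕜 E M)] [LieRinehartRing (SmoothFun 𝕜 E M) A]
    [LieRinehartAlgebra 𝕜 (SmoothFun 𝕜 E M) A]
    [Module.Finite (SmoothFun 𝕜 E M) A] [Module.Projective (SmoothFun 𝕜 E M) A]
    (htransitive : Function.Surjective (LieRinehartAlgebra.anchor 𝕜 (SmoothFun 𝕜 E M) A))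
    (U : ι → Opens M) (T : ∀ i, LocalTriv 𝕜 E g A (U i)) :
    (∀ (i : ι) (q : ℕ) (θ : KForm 𝕜 (SmoothFun 𝕜 E M) A q),
      dTLA ((T i).localForm θ) = (T i).localForm (dHat θ)) ∧
    (∀ (i j : ι) (q : ℕ) (θ : KForm 𝕜 (SmoothFun 𝕜 E M) A q),
      dTLA (((T i).restrict inf_le_left : LocalTriv 𝕜 E g A (U i ⊓ U j)).localForm θ) =
        (T i).changeTriv (T j) (q + 1)
          (dTLA (((T j).restrict inf_le_right : LocalTriv 𝕜 E g A (U i ⊓ U j)).localForm θ))) ∧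
    (∀ i j : ι, IsGradedDiffLieIso 𝕜 (SmoothFun 𝕜 E ↥(U i ⊓ U j)) g
      fun q => (T i).changeTriv (T j) q) := by
  exact mainTheorem2_general U T
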